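/- Let $\Lambda$ be a (commutative) discrete valuation ring whose maximal ideal is generated by $p$. An embedding $(A\subset B)$ consists of a $\Lambda$-module $B$ of finite length and a submodule $A$; it is cyclic if $A$ is a cyclic module (possibly $0$). An isomorphism $(A\subset B)\cong(A'\subset B')$ is an isomorphism $f:B\to B'$ with $f(A)=A'$. A cyclic embedding is a pole if $A$ is an indecomposable module and $(A\subset B)$ is an indecomposable object, i.e. it is nonzero and is not isomorphic to a direct sum $(A_1\oplus A_2\subset B_1\oplus B_2)$ of two nonzero embeddings. A tableau is an increasing sequence of partitions $\Gamma=[\gamma^{(0)}\subset\gamma^{(1)}\subset\cdots\subset\gamma^{(r)}]$, where repetitions at the end are immaterial (put $\gamma^{(i)}=\gamma^{(r)}$ for $i\ge r$). It is pictured as the Young diagram of $\gamma^{(r)}$, whose column lengths are the parts of $\gamma^{(r)}$, in which each box of $\gamma^{(e)}\setminus\gamma^{(e-1)}$ $(e\ge 1)$ carries the entry $e$ and the boxes of $\gamma^{(0)}$ are empty. It is an LR-tableau if the entries are weakly increasing in each row and strictly increasing in each column and if, for all $c$ and all $e\ge 1$, the columns from the $c$-th one on to the right contain at least as many entries $e$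 as entries $e+1$. The tableau of an embedding $(A\subset B)$ is the one for which $B/p^iA\cong\bigoplus_j\Lambda/(p^{\gamma^{(i)}_j})$ for all $i\ge 0$. The height $h(x)\in\mathbb N_0\cup\{\infty\}$ of $x\in B$ is the largest $m$ with $x\in p^mB$, and $h(0)=\infty$. The height sequence of $a\in B$ is $(m_i)_{i\ge 0}$ with $m_i=h(p^ia)$. It has a gap after $m_\ell<\infty$ if $m_{\ell+1}>m_\ell+1$ (in particular, if $m_{\ell+1}=\infty$). Then: 1. Each cyclic embedding has exactly one tableau, and sending a cyclic embedding to its tableau induces a bijection between the isomorphism classes of cyclic embeddings and the LR-tableaux in which each entry occurs at most once. 2. Let $(A\subset B)$ be a cyclic embedding with tableau $\Gamma$, and let $a$ be any generator of $A$. Then $(A\subset B)$ is a pole if and only if $A\neq 0$ and the number of columns of $\Gamma$ (including columns of empty boxes) equals the number of gaps in the height sequence of $a$ in $B$. -/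

import Mathlib

open scoped Pointwise

universe u

/-! ## Tableaux

A partition is represented by its Young diagram, drawn so that the parts of the partition are the
lengths of the columns. In Mathlib a cell `(i, j)` lies in row `i` and column `j`, both counted
from `0` (row `0` on top, column `0` on the left). -/

/-- A tableau `[γ⁽⁰⁾, γ⁽¹⁾, …, γ⁽ʳ⁾]`: an increasing finite sequence of partitions, continued by
the constant value `γ⁽ʳ⁾`, so that repetitions at the end of the sequence are immaterial. -/
@[ext]
structure Tableau where
  /-- The partition `γ⁽ⁱ⁾`. -/
  part : ℕ → YoungDiagram
  mono : Monotone part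
  eventually_const : ∃ r, ∀ i, r ≤ i → part i = part r

namespace Tableau

/-- The boxes which carry the entry `e`, where `e ≥ 1`: those of the skew diagram
`γ⁽ᵉ⁾ \ γ⁽ᵉ⁻¹⁾`. (No box carries the entry `0`.) -/
def boxes (Γ : Tableau) (e : ℕ) : Finset (ℕ × ℕ) :=
  (Γ.part e).cells \ (Γ.part (e - 1)).cells

/-- `Γ.IsOuter β` : the Young diagram on which `Γ` is drawn (the last partition) is `β`. -/
def IsOuter (Γ : Tableau) (β : YoungDiagram) : Prop :=
  ∃ r, ∀ i, r ≤ i → Γ.part i = β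

theorem exists_isOuter (Γ : Tableau) : ∃ β, Γ.IsOuter β := by
  obtain ⟨r, hr⟩ := Γ.eventually_const
  exact ⟨Γ.part r, r, hr⟩

/-- The last partition `β = γ⁽ʳ⁾` of the tableau. -/
noncomputable def outer (Γ : Tableau) : YoungDiagram := Γ.exists_isOuter.choose

/-- The number of columns of the tableau (columns of empty boxes are counted). -/
noncomputable def numColumns (Γ : Tableau) : ℕ := Γ.outer.rowLen 0

/-- The Littlewood-Richardson condition. -/
structure IsLR (Γ : Tableau) : Prop where
  /-- In each row the entries are weakly increasing. -/
  row_weak : ∀ i j₁ j₂ e₁ e₂, j₁ < j₂ → (i, j₁) ∈ Γ.boxes e₁ → (i, j₂) ∈ Γ.boxes e₂ → e₁ ≤ e₂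
  /-- In each column the entries are strictly increasing. -/
  col_strict : ∀ i₁ i₂ j e₁ e₂, i₁ < i₂ → (i₁, j) ∈ Γ.boxes e₁ → (i₂, j) ∈ Γ.boxes e₂ → e₁ < e₂
  /-- Lattice permutation property: in the columns from the `c`-th one on to the right, there are
  at least as many entries `e` as there are entries `e + 1`. -/
  lattice : ∀ c e, 1 ≤ e →
    ((Γ.boxes (e + 1)).filter fun b => c ≤ b.2).card ≤ ((Γ.boxes e).filter fun b => c ≤ b.2).card

/-- Each entry occurs at most once. -/
def EntriesAtMostOnce (Γ : Tableau) : Prop := ∀ e, (Γ.boxes e).card ≤ 1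

end Tableau

/-! ## Embeddings -/

/-- `M` is isomorphic to `N_β = ⨁ⱼ Λ / (p ^ βⱼ)`, where `βⱼ` are the column lengths of `β`. -/
def HasPartition {Λ : Type u} [CommRing Λ] (p : Λ) (M : Type u) [AddCommGroup M] [Module Λ M]
    (β : YoungDiagram) : Prop :=
  Nonempty (M ≃ₗ[Λ] ((j : Fin (β.rowLen 0)) → Λ ⧸ Ideal.span {p ^ β.colLen j}))

/-- A module is indecomposable if it is nonzero and not the direct sum of two nonzero
submodules. -/
def IsIndecomposableModule (Λ : Type u) [CommRing Λ] (M : Type u) [AddCommGroup M]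
    [Module Λ M] : Prop :=
  Nontrivial M ∧ ∀ U V : Submodule Λ M, IsCompl U V → U = ⊥ ∨ V = ⊥

/-- An embedding `(A ⊂ B)` of a submodule `A` in a module `B` of finite length. -/
structure SubEmbedding (Λ : Type u) [CommRing Λ] where
  /-- The ambient module `B`. -/
  B : Type u
  [addCommGroup : AddCommGroup B]
  [module : Module Λ B]
  finiteLength : IsFiniteLength Λ B
  /-- The submodule `A`. -/
  A : Submodule Λ B

attribute [instance] SubEmbedding.addCommGroup SubEmbedding.module

namespace SubEmbedding

variable {Λ : Type u} [CommRing Λ]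

/-- Isomorphism of embeddings. -/
def Iso (E F : SubEmbedding Λ) : Prop :=
  ∃ f : E.B ≃ₗ[Λ] F.B, E.A.map (f : E.B →ₗ[Λ] F.B) = F.A

theorem Iso.refl (E : SubEmbedding Λ) : E.Iso E :=
  ⟨LinearEquiv.refl Λ E.B, by simp⟩

theorem Iso.symm {E F : SubEmbedding Λ} (h : E.Iso F) : F.Iso E := by
  obtain ⟨f, hf⟩ := h
  refine ⟨f.symm, ?_⟩
  rw [← hf, ← Submodule.map_comp]
  simp

theorem Iso.trans {E F G : SubEmbedding Λ} (h : E.Iso F) (h' : F.Iso G) : E.Iso G := by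
  obtain ⟨f, hf⟩ := h
  obtain ⟨g, hg⟩ := h'
  refine ⟨f.trans g, ?_⟩
  rw [← hg, ← hf, ← Submodule.map_comp]
  rfl

/-- The direct sum `(A ⊕ A' ⊂ B ⊕ B')`. -/
def directSum (E F : SubEmbedding Λ) : SubEmbedding Λ where
  B := E.B × F.B
  finiteLength := by
    have hE := isFiniteLength_iff_isNoetherian_isArtinian.mp E.finiteLength
    have hF := isFiniteLength_iff_isNoetherian_isArtinian.mp F.finiteLength
    have := hE.1
    have := hE.2
    have := hF.1
    have := hF.2
    exact isFiniteLength_iff_isNoetherian_isArtinian.mpr ⟨inferInstance, inferInstance⟩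
  A := E.A.prod F.A

/-- `(A ⊂ B)` is an indecomposable object: it is nonzero and not isomorphic to the direct sum of
two nonzero embeddings. (An embedding is zero precisely if its ambient module is.) -/
def IsIndecomposable (E : SubEmbedding Λ) : Prop :=
  Nontrivial E.B ∧
    ∀ F G : SubEmbedding Λ, E.Iso (F.directSum G) → Subsingleton F.B ∨ Subsingleton G.B

/-- `(A ⊂ B)` is cyclic if `A` is a cyclic module (possibly zero). -/
def IsCyclic (E : SubEmbedding Λ) : Prop := ∃ a : E.B, E.A = Submodule.span Λ {a}

/-- `(A ⊂ B)` is a pole if `A` is an indecomposable module and `(A ⊂ B)` is an indecomposable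
object. -/
def IsPole (E : SubEmbedding Λ) : Prop :=
  IsIndecomposableModule Λ E.A ∧ E.IsIndecomposable

/-- `Γ` is the tableau of `(A ⊂ B)`: its `i`-th partition is the one of `B / pⁱA`. -/
def HasTableau (p : Λ) (E : SubEmbedding Λ) (Γ : Tableau) : Prop :=
  ∀ i : ℕ, HasPartition p (E.B ⧸ (p ^ i • E.A)) (Γ.part i)

end SubEmbedding

/-- Cyclic embeddings. -/
abbrev CyclicEmbedding (Λ : Type u) [CommRing Λ] := {E : SubEmbedding Λ // E.IsCyclic}

/-- Isomorphism as an equivalence relation on cyclic embeddings. -/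
def cyclicEmbeddingSetoid (Λ : Type u) [CommRing Λ] : Setoid (CyclicEmbedding Λ) where
  r E F := E.1.Iso F.1
  iseqv := ⟨fun E => .refl E.1, fun h => h.symm, fun h h' => h.trans h'⟩

/-- The isomorphism classes of cyclic embeddings. -/
abbrev CyclicEmbeddingClass (Λ : Type u) [CommRing Λ] := Quotient (cyclicEmbeddingSetoid Λ)

/-- The isomorphism class of a cyclic embedding. -/
def CyclicEmbedding.isoClass {Λ : Type u} [CommRing Λ] (E : CyclicEmbedding Λ) :
    CyclicEmbeddingClass Λ :=
  Quotient.mk (cyclicEmbeddingSetoid Λ) E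

/-- Tableaux with the Littlewood-Richardson property in which each entry occurs at most once. -/
abbrev MultiplicityFreeLRTableau := {Γ : Tableau // Γ.IsLR ∧ Γ.EntriesAtMostOnce}

/-! ## Heights -/

/-- The height of `x` in `B`: the largest `m` with `x ∈ pᵐB`, and `∞` if there is none. -/
noncomputable def height {Λ : Type u} [CommRing Λ] (p : Λ) {B : Type u} [AddCommGroup B]
    [Module Λ B] (x : B) : ℕ∞ :=
  ⨆ (m : ℕ) (_ : x ∈ p ^ m • (⊤ : Submodule Λ B)), (m : ℕ∞)

/-- The height sequence `(h(pⁱa))ᵢ` of `a` in `B`. -/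
noncomputable def heightSeq {Λ : Type u} [CommRing Λ] (p : Λ) {B : Type u} [AddCommGroup B]
    [Module Λ B] (a : B) : ℕ → ℕ∞ :=
  fun i => height p (p ^ i • a)

/-- The number of gaps of a height sequence: there is a gap after the finite entry `m_ℓ` if
`m_{ℓ+1} > m_ℓ + 1`; this includes the case that `m_ℓ` is the last finite entry. -/
noncomputable def numGaps (m : ℕ → ℕ∞) : ℕ := {l : ℕ | m l + 1 < m (l + 1)}.ncard

/-! For a generator `a` of `A`, everything is encoded in two invariants: the row lengths of `B`,
that is the lengths of `pᵏB / pᵏ⁺¹B`, and the height sequence of `a`. Passing from `B / (y)` to `B /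
(p y)` adds one box to the partition, in row `h(y)`, if `y ≠ 0`, and nothing if `y = 0`
(`HasRows.quotient_span_smul`). So the tableau is the shape of `B` together with the rows `h(pᵉa)`
of the entries `e + 1`. Since heights strictly increase while finite, such tableaux are multiplicity
free and LR, and the lattice condition gives the converse.

The engine is a splitting (`IsFirstGap.exists_equiv`). If `h(a) = x` and the first gap is after
index `l`, then `B` has a summand `Λ / (pˣ⁺ˡ⁺¹)` in which `a` has component `pˣ`, and the height
sequence of the other component is that of `a` with this gap removed. Induction along this splitting
shows that the two invariants determine the pair `(B, a)` (`exists_equiv_of_heightSeq_eq`), that all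
admissible invariants occur (`exists_heightSeq_eq`), and that `a` lies in a summand with exactly as
many columns as there are gaps (`exists_equiv_prod_numGaps`).

For poles: the complement of that summand splits off with zero submodule, so in an indecomposable
object it vanishes. Conversely, in any decomposition a cyclic `A` lies in one of the two terms; that
term has at least as many columns as there are gaps, which leaves none for the other. -/

section Module

variable {Λ : Type u} [CommRing Λ] {p : Λ}
variable {M : Type u} [AddCommGroup M] [Module Λ M]
variable {N : Type u} [AddCommGroup N] [Module Λ N]

/-! ### The submodules `pᵏM` and their lengths -/

theorem mem_pow_smul_top {k : ℕ} {x : M} :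
    x ∈ p ^ k • (⊤ : Submodule Λ M) ↔ ∃ y, p ^ k • y = x := by
  simp [Submodule.mem_smul_pointwise_iff_exists]

theorem pow_smul_top_anti {k l : ℕ} (h : k ≤ l) :
    p ^ l • (⊤ : Submodule Λ M) ≤ p ^ k • ⊤ := by
  intro x hx
  obtain ⟨y, rfl⟩ := mem_pow_smul_top.mp hx
  refine mem_pow_smul_top.mpr ⟨p ^ (l - k) • y, ?_⟩
  rw [smul_smul, ← pow_add, Nat.add_sub_cancel' h]

theorem length_eq_length_map_add (f : M →ₗ[Λ] N) (S : Submodule Λ M) :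
    Module.length Λ S =
      Module.length Λ (S ⊓ LinearMap.ker f : Submodule Λ M) + Module.length Λ (S.map f) := by
  refine Module.length_eq_add_of_exact (Submodule.inclusion inf_le_left) (f.submoduleMap S)
    (Submodule.inclusion_injective _) (f.submoduleMap_surjective S) ?_
  rintro ⟨x, hx⟩
  constructor
  · intro h
    have : f x = 0 := congrArg Subtype.val h
    exact ⟨⟨x, hx, this⟩, rfl⟩
  · rintro ⟨⟨y, hy, hy'⟩, h⟩
    have : y = x := congrArg Subtype.val h
    subst this
    exact Subtype.ext hy'

theorem pow_smul_mk_one (n k : ℕ) :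
    p ^ k • (1 : Λ ⧸ Ideal.span {p ^ n}) = Ideal.Quotient.mk _ (p ^ k) := by
  rw [Algebra.smul_def, mul_one]; rfl

theorem span_one_quotient (n : ℕ) :
    Submodule.span Λ {(1 : Λ ⧸ Ideal.span {p ^ n})} = ⊤ := by
  rw [eq_top_iff]
  rintro x -
  obtain ⟨y, rfl⟩ := Ideal.Quotient.mk_surjective x
  refine Submodule.mem_span_singleton.mpr ⟨y, ?_⟩
  rw [Algebra.smul_def, mul_one]; rfl

/-- Infinite length gives the junk value 0; `coe_powLength` shows that the value is genuine for
modules of finite length. -/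
noncomputable def powLength (p : Λ) (M : Type u) [AddCommGroup M] [Module Λ M] (k : ℕ) : ℕ :=
  (Module.length Λ (p ^ k • (⊤ : Submodule Λ M) : Submodule Λ M)).toNat

theorem coe_powLength [IsNoetherian Λ M] [IsArtinian Λ M] (k : ℕ) :
    (powLength p M k : ℕ∞) = Module.length Λ (p ^ k • (⊤ : Submodule Λ M) : Submodule Λ M) :=
  ENat.natCast_toNat Module.length_ne_top

theorem map_pow_smul_top (f : M →ₗ[Λ] N) (hf : Function.Surjective f) (k : ℕ) :
    (p ^ k • (⊤ : Submodule Λ M)).map f = p ^ k • ⊤ := by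
  ext x
  simp only [Submodule.mem_map, mem_pow_smul_top]
  constructor
  · rintro ⟨_, ⟨y, rfl⟩, rfl⟩
    exact ⟨f y, (f.map_smul _ _).symm⟩
  · rintro ⟨y, rfl⟩
    obtain ⟨z, rfl⟩ := hf y
    exact ⟨_, ⟨z, rfl⟩, f.map_smul _ _⟩

theorem powLength_congr (f : M ≃ₗ[Λ] N) (k : ℕ) : powLength p M k = powLength p N k := by
  have h := map_pow_smul_top (p := p) f.toLinearMap f.surjective k
  rw [powLength, powLength, ← h]
  exact congrArg ENat.toNat (f.submoduleMap _).length_eq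

theorem powLength_prod [IsNoetherian Λ M] [IsArtinian Λ M] [IsNoetherian Λ N] [IsArtinian Λ N]
    (k : ℕ) : powLength p (M × N) k = powLength p M k + powLength p N k := by
  have h := length_eq_length_map_add (LinearMap.snd Λ M N) (p ^ k • (⊤ : Submodule Λ (M × N)))
  rw [map_pow_smul_top _ LinearMap.snd_surjective] at h
  have h2 : p ^ k • ⊤ ⊓ LinearMap.ker (LinearMap.snd Λ M N) =
      (p ^ k • (⊤ : Submodule Λ M)).map (LinearMap.inl Λ M N) := by
    ext ⟨x, y⟩
    simp only [Submodule.mem_inf, Submodule.mem_map, mem_pow_smul_top, LinearMap.mem_ker,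
      LinearMap.snd_apply, LinearMap.inl_apply, Prod.exists, Prod.mk.injEq]
    constructor
    · rintro ⟨⟨s, t, h⟩, rfl⟩
      exact ⟨x, ⟨s, congrArg Prod.fst h⟩, rfl, rfl⟩
    · rintro ⟨_, ⟨s, rfl⟩, rfl, rfl⟩
      exact ⟨⟨s, 0, by simp⟩, rfl⟩
  rw [h2, ← ((Submodule.equivMapOfInjective (LinearMap.inl Λ M N) LinearMap.inl_injective
    _).length_eq)] at h
  simp only [← coe_powLength] at h
  exact_mod_cast h

end Module

theorem mk_pow_eq_zero_iff {Λ : Type u} [CommRing Λ] [IsDomain Λ] {p : Λ} (hp : Irreducible p)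
    {n k : ℕ} :
    Ideal.Quotient.mk (Ideal.span {p ^ n}) (p ^ k) = 0 ↔ n ≤ k := by
  rw [Ideal.Quotient.eq_zero_iff_mem, Ideal.mem_span_singleton,
    pow_dvd_pow_iff hp.ne_zero hp.not_isUnit]

/-! ### Lengths of cyclic modules and of quotients by them -/

section DiscreteValuationRing

variable {Λ : Type u} [CommRing Λ] [IsDomain Λ] [IsDiscreteValuationRing Λ] {p : Λ}
variable {M : Type u} [AddCommGroup M] [Module Λ M]

theorem dvd_or_isUnit (hp : Irreducible p) (s : Λ) : p ∣ s ∨ IsUnit s := by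
  by_cases h : s = 0
  · exact Or.inl (h ▸ dvd_zero p)
  obtain ⟨n, u, rfl⟩ := IsDiscreteValuationRing.eq_unit_mul_pow_irreducible h hp
  cases n with
  | zero => right; simp
  | succ n => left; exact Dvd.intro_left _ (by rw [pow_succ, ← mul_assoc])

theorem isUnit_one_add_mul (hp : Irreducible p) (s : Λ) : IsUnit (1 + p * s) := by
  refine (dvd_or_isUnit hp _).resolve_left fun h => hp.not_isUnit ?_
  exact isUnit_of_dvd_one ((dvd_add_left (dvd_mul_right p s)).mp h)

/-- The descending chain `pⁿM` stabilizes, and Nakayama's lemma makes its stable value zero. -/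
theorem exists_pow_smul_top_eq_bot (hp : Irreducible p) [IsNoetherian Λ M] [IsArtinian Λ M] :
    ∃ n : ℕ, p ^ n • (⊤ : Submodule Λ M) = ⊥ := by
  obtain ⟨n, hn⟩ := IsArtinian.monotone_stabilizes (R := Λ) (M := M)
    ⟨fun n => OrderDual.toDual (p ^ n • (⊤ : Submodule Λ M)), fun _ _ h => pow_smul_top_anti h⟩
  refine ⟨n, ?_⟩
  have h1 : p ^ n • (⊤ : Submodule Λ M) = p ^ (n + 1) • ⊤ := hn (n + 1) (Nat.le_succ n)
  refine Submodule.eq_bot_of_le_smul_of_le_jacobson_bot (Ideal.span {p}) _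
    (IsNoetherian.noetherian _) ?_ ?_
  · rw [Submodule.ideal_span_singleton_smul, smul_smul, ← pow_succ']
    exact h1.le
  · rw [IsLocalRing.jacobson_eq_maximalIdeal _ bot_ne_top, hp.maximalIdeal_eq]

theorem exists_pow_smul_eq_zero (hp : Irreducible p) [IsNoetherian Λ M] [IsArtinian Λ M] :
    ∃ n : ℕ, ∀ x : M, p ^ n • x = 0 := by
  obtain ⟨n, hn⟩ := exists_pow_smul_top_eq_bot (M := M) hp
  refine ⟨n, fun x => ?_⟩
  have : p ^ n • x ∈ p ^ n • (⊤ : Submodule Λ M) := mem_pow_smul_top.mpr ⟨x, rfl⟩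
  simpa [hn] using this

theorem length_span_singleton_eq_one (hp : Irreducible p) {x : M} (hx : x ≠ 0)
    (hpx : p • x = 0) : Module.length Λ (Submodule.span Λ {x}) = 1 := by
  rw [Module.length_eq_one_iff, isSimpleModule_iff_isAtom]
  refine ⟨by simpa using hx, fun S hS => ?_⟩
  rw [eq_bot_iff]
  intro z hz
  obtain ⟨c, rfl⟩ := Submodule.mem_span_singleton.mp (hS.le hz)
  rcases dvd_or_isUnit hp c with ⟨d, rfl⟩ | hc
  · rw [mul_comm, mul_smul, hpx, smul_zero]; exact zero_mem _
  · refine absurd ?_ hS.not_ge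
    rw [Submodule.span_singleton_le_iff_mem]
    exact (Submodule.smul_mem_iff_of_isUnit _ hc).mp hz

theorem length_span_singleton_eq_add_one (hp : Irreducible p) {x : M}
    (hx : x ≠ 0) (hn : ∃ n : ℕ, p ^ n • x = 0) : Module.length Λ (Submodule.span Λ {x}) =
      Module.length Λ (Submodule.span Λ {p • x}) + 1 := by
  have hle : Submodule.span Λ {p • x} ≤ Submodule.span Λ {x} := by
    rw [Submodule.span_singleton_le_iff_mem]
    exact Submodule.smul_mem _ _ (Submodule.mem_span_singleton_self x)
  rw [length_eq_length_map_add (Submodule.span Λ {p • x}).mkQ, Submodule.ker_mkQ,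
    inf_eq_right.mpr hle, Submodule.map_span, Set.image_singleton,
    length_span_singleton_eq_one hp (x := (Submodule.span Λ {p • x}).mkQ x)]
  · rw [Submodule.mkQ_apply, ne_eq, Submodule.Quotient.mk_eq_zero, Submodule.mem_span_singleton]
    rintro ⟨c, hc⟩
    apply hx
    obtain ⟨n, hn⟩ := hn
    -- From `x = c p x` the unit `1 - p c` annihilates `x`.
    have hu : IsUnit (1 + p * (-c)) := isUnit_one_add_mul hp _
    have h0 : (1 + p * (-c)) • x = 0 := by
      rw [add_smul, one_smul, mul_neg, neg_smul, mul_comm, mul_smul, hc, add_neg_cancel]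
    exact hu.smul_eq_zero.mp h0
  · rw [Submodule.mkQ_apply, ← Submodule.Quotient.mk_smul, Submodule.Quotient.mk_eq_zero]
    exact Submodule.mem_span_singleton_self _

theorem length_span_singleton (hp : Irreducible p) (n : ℕ) {x : M}
    (h : ∀ k < n, p ^ k • x ≠ 0) (hn : p ^ n • x = 0) :
    Module.length Λ (Submodule.span Λ {x}) = n := by
  induction n generalizing x with
  | zero =>
    have : x = 0 := by simpa using hn
    subst this
    rw [Submodule.span_zero_singleton, Module.length_bot, Nat.cast_zero]
  | succ n ih =>
    have hx : x ≠ 0 := by simpa using h 0 (Nat.succ_pos n)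
    rw [length_span_singleton_eq_add_one hp hx ⟨_, hn⟩, ih]
    · norm_num
    · intro k hk
      rw [smul_smul, ← pow_succ]
      exact h _ (by omega)
    · rwa [smul_smul, ← pow_succ]

theorem powLength_quotient (hp : Irreducible p) (n k : ℕ) :
    powLength p (Λ ⧸ Ideal.span {p ^ n}) k = n - k := by
  rw [powLength, ← span_one_quotient, Submodule.smul_span, Set.smul_set_singleton,
    length_span_singleton hp (n - k), ENat.toNat_natCast]
  · intro l hl
    rw [smul_smul, ← pow_add, pow_smul_mk_one, Ne, mk_pow_eq_zero_iff hp]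
    omega
  · rw [smul_smul, ← pow_add, pow_smul_mk_one, mk_pow_eq_zero_iff hp]
    omega

theorem isArtinian_quotient (hp : Irreducible p) (n : ℕ) :
    IsArtinian Λ (Λ ⧸ Ideal.span {p ^ n}) := by
  refine (isFiniteLength_iff_isNoetherian_isArtinian.mp (Module.length_ne_top_iff.mp ?_)).2
  rw [← Module.length_top, ← span_one_quotient, length_span_singleton hp n]
  · exact ENat.natCast_ne_top n
  · intro l hl
    rw [pow_smul_mk_one, Ne, mk_pow_eq_zero_iff hp]
    omega
  · rw [pow_smul_mk_one, mk_pow_eq_zero_iff hp]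

/-- The length of `pᵏ(M / (z))` is that of `pᵏM` minus that of `pᵏM ∩ (z)`. For `z = y` and `z = p
y` these intersections coincide unless `0 ≠ y ∈ pᵏM`, because a unit multiple of `y` lies in `pᵏM`
only if `y` does. In the exceptional case they are `(y)` and `(p y)`, whose lengths differ by one.
-/
theorem powLength_quotient_span (hp : Irreducible p) [IsNoetherian Λ M] [IsArtinian Λ M]
    (y : M) (k : ℕ) [Decidable (y ≠ 0 ∧ y ∈ p ^ k • (⊤ : Submodule Λ M))] :
    powLength p (M ⧸ Submodule.span Λ {p • y}) k = powLength p (M ⧸ Submodule.span Λ {y}) k +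
      if y ≠ 0 ∧ y ∈ p ^ k • (⊤ : Submodule Λ M) then 1 else 0 := by
  have key (z : M) : (powLength p M k : ℕ∞) =
      Module.length Λ (p ^ k • ⊤ ⊓ Submodule.span Λ {z} : Submodule Λ M) +
        powLength p (M ⧸ Submodule.span Λ {z}) k := by
    have h := length_eq_length_map_add (Submodule.span Λ {z}).mkQ (p ^ k • (⊤ : Submodule Λ M))
    rwa [Submodule.ker_mkQ, map_pow_smul_top _ (Submodule.mkQ_surjective _), ← coe_powLength,
      ← coe_powLength] at h
  have hy := key y
  have hpy := key (p • y)
  rw [hy] at hpy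
  split_ifs with h
  · have hm : p • y ∈ p ^ k • (⊤ : Submodule Λ M) := Submodule.smul_mem _ _ h.2
    rw [inf_eq_right.mpr ((Submodule.span_singleton_le_iff_mem _ _).mpr h.2),
      inf_eq_right.mpr ((Submodule.span_singleton_le_iff_mem _ _).mpr hm),
      length_span_singleton_eq_add_one hp h.1] at hpy
    · have hfin : Module.length Λ (Submodule.span Λ {p • y}) ≠ ⊤ := Module.length_ne_top
      rw [← ENat.natCast_toNat hfin] at hpy
      norm_cast at hpy
      omega
    · obtain ⟨n, hn⟩ := exists_pow_smul_eq_zero (M := M) hp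
      exact ⟨n, hn y⟩
  · have : p ^ k • ⊤ ⊓ Submodule.span Λ {y} = p ^ k • ⊤ ⊓ Submodule.span Λ {p • y} := by
      apply le_antisymm
      · rintro z ⟨hz, hz'⟩
        refine ⟨hz, ?_⟩
        obtain ⟨c, rfl⟩ := Submodule.mem_span_singleton.mp hz'
        rcases dvd_or_isUnit hp c with ⟨d, rfl⟩ | hc
        · exact Submodule.mem_span_singleton.mpr ⟨d, by rw [smul_smul, mul_comm]⟩
        · have hy : y ∈ p ^ k • (⊤ : Submodule Λ M) :=
            (Submodule.smul_mem_iff_of_isUnit _ hc).mp hz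
          have : y = 0 := by
            by_contra h0
            exact h ⟨h0, hy⟩
          simp [this]
      · refine inf_le_inf_left _ ((Submodule.span_singleton_le_iff_mem _ _).mpr ?_)
        exact Submodule.smul_mem _ _ (Submodule.mem_span_singleton_self y)
    rw [this] at hpy
    have hfin : Module.length Λ (p ^ k • ⊤ ⊓ Submodule.span Λ {p • y} : Submodule Λ M) ≠ ⊤ :=
      Module.length_ne_top
    rw [← ENat.natCast_toNat hfin] at hpy
    norm_cast at hpy
    omega

end DiscreteValuationRing

/-! ### Heights and height sequences -/

section Height

variable {Λ : Type u} [CommRing Λ] {p : Λ}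
variable {M : Type u} [AddCommGroup M] [Module Λ M]
variable {N : Type u} [AddCommGroup N] [Module Λ N]

/-- The exponents `m` with `x ∈ pᵐM` are closed downwards, so the supremum is tested by membership.
Later comparisons of heights go through this criterion. -/
theorem natCast_le_height_iff {k : ℕ} {x : M} :
    (k : ℕ∞) ≤ height p x ↔ x ∈ p ^ k • (⊤ : Submodule Λ M) := by
  constructor
  · intro h
    by_contra hx
    have hk : k ≠ 0 := by
      rintro rfl
      exact hx (mem_pow_smul_top.mpr ⟨x, by simp⟩)
    have h2 : height p x ≤ ((k - 1 : ℕ) : ℕ∞) := by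
      refine iSup₂_le fun m hm => ?_
      have : ¬ k ≤ m := fun hkm => hx (pow_smul_top_anti hkm hm)
      exact_mod_cast (show m ≤ k - 1 by omega)
    have h3 := h.trans h2
    norm_cast at h3
    omega
  · intro h
    exact le_iSup₂_of_le k h le_rfl

theorem pow_smul_mem_pow_smul_top {j k : ℕ} (h : k ≤ j) (x : M) :
    p ^ j • x ∈ p ^ k • (⊤ : Submodule Λ M) :=
  pow_smul_top_anti h (mem_pow_smul_top.mpr ⟨x, rfl⟩)

theorem height_zero : height p (0 : M) = ⊤ := by
  refine top_le_iff.mp (ENat.forall_natCast_le_iff_le.mp fun k _ => ?_)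
  exact natCast_le_height_iff.mpr (zero_mem _)

theorem height_prod (x : M) (y : N) : height p (x, y) = min (height p x) (height p y) := by
  refine ENat.eq_of_forall_natCast_le_iff fun k => ?_
  rw [le_min_iff]
  simp only [natCast_le_height_iff, mem_pow_smul_top, Prod.exists, Prod.smul_mk, Prod.mk.injEq]
  constructor
  · rintro ⟨s, t, h1, h2⟩
    exact ⟨⟨s, h1⟩, t, h2⟩
  · rintro ⟨⟨s, h1⟩, t, h2⟩
    exact ⟨s, t, h1, h2⟩

theorem height_congr (f : M ≃ₗ[Λ] N) (x : M) : height p (f x) = height p x := by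
  refine ENat.eq_of_forall_natCast_le_iff fun k => ?_
  simp only [natCast_le_height_iff, mem_pow_smul_top]
  constructor
  · rintro ⟨y, hy⟩
    exact ⟨f.symm y, by rw [← map_smul, hy, f.symm_apply_apply]⟩
  · rintro ⟨y, rfl⟩
    exact ⟨f y, (map_smul f _ _).symm⟩

theorem heightSeq_congr (f : M ≃ₗ[Λ] N) (x : M) : heightSeq p (f x) = heightSeq p x := by
  funext i
  rw [heightSeq, ← map_smul, height_congr, heightSeq]

theorem heightSeq_prod (x : M) (y : N) (i : ℕ) :
    heightSeq p (x, y) i = min (heightSeq p x i) (heightSeq p y i) :=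
  height_prod _ _

theorem heightSeq_zero (i : ℕ) : heightSeq p (0 : M) i = ⊤ := by
  rw [heightSeq, smul_zero, height_zero]

theorem height_add_one_le (x : M) : height p x + 1 ≤ height p (p • x) := by
  refine ENat.forall_natCast_le_iff_le.mp fun k hk => ?_
  cases k with
  | zero => exact zero_le
  | succ k =>
    rw [Nat.cast_add_one, ENat.add_le_add_iff_right ENat.one_ne_top, natCast_le_height_iff] at hk
    obtain ⟨y, rfl⟩ := mem_pow_smul_top.mp hk
    rw [natCast_le_height_iff, smul_smul, ← pow_succ']
    exact pow_smul_mem_pow_smul_top le_rfl y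

theorem heightSeq_add_one_le (x : M) (i : ℕ) : heightSeq p x i + 1 ≤ heightSeq p x (i + 1) := by
  rw [heightSeq, heightSeq, pow_succ', mul_smul]
  exact height_add_one_le _

end Height

/-! ### Sequences of heights -/

section Sequences

theorem add_le_of_add_one_le {m : ℕ → ℕ∞} (hm : ∀ i, m i + 1 ≤ m (i + 1)) (i j : ℕ) :
    m i + j ≤ m (i + j) := by
  induction j with
  | zero => simp
  | succ j ih =>
    rw [Nat.cast_add_one, ← add_assoc, ← add_assoc]
    exact (add_le_add_left ih 1).trans (hm _)

/-- The first gap of `m` is after the entry with index `l`, and `m` starts with `x`. -/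
structure IsFirstGap (m : ℕ → ℕ∞) (l x : ℕ) : Prop where
  eq_add : ∀ i ≤ l, m i = (x + i : ℕ)
  lt : ((x + l + 1 : ℕ) : ℕ∞) < m (l + 1)

/-- A sequence that reaches `⊤` cannot equal `x + i` for all `i`; the first failure is the first
gap. -/
theorem exists_isFirstGap {m : ℕ → ℕ∞} (hm : ∀ i, m i + 1 ≤ m (i + 1)) (htop : ∃ i, m i = ⊤)
    (h0 : m 0 ≠ ⊤) : ∃ l x, IsFirstGap m l x := by
  obtain ⟨x, hx⟩ := ENat.ne_top_iff_exists.mp h0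
  have hgap : ∃ l, m (l + 1) ≠ (x + (l + 1) : ℕ) := by
    obtain ⟨i, hi⟩ := htop
    cases i with
    | zero => exact absurd hi h0
    | succ l => exact ⟨l, by rw [hi]; exact (ENat.natCast_ne_top _).symm⟩
  classical
  have heq : ∀ i ≤ Nat.find hgap, m i = (x + i : ℕ) := by
    intro i hi
    cases i with
    | zero => simp [← hx]
    | succ i => exact not_not.mp (Nat.find_min hgap (show i < Nat.find hgap by omega))
  refine ⟨Nat.find hgap, x, heq, lt_of_le_of_ne ?_ (Nat.find_spec hgap).symm⟩
  have := hm (Nat.find hgap)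
  rw [heq _ le_rfl] at this
  exact_mod_cast this

/-- The sequence obtained from `m` by replacing the entries with index at most `l` so that they
lead to `m (l + 1)` without a gap. -/
def dropGap (l : ℕ) (m : ℕ → ℕ∞) (i : ℕ) : ℕ∞ := m (max i (l + 1)) - (l + 1 - i : ℕ)

theorem dropGap_of_lt {l i : ℕ} (m : ℕ → ℕ∞) (h : l < i) : dropGap l m i = m i := by
  rw [dropGap, max_eq_left (by omega), Nat.sub_eq_zero_of_le (by omega), Nat.cast_zero, tsub_zero]

theorem dropGap_of_le {l i : ℕ} (m : ℕ → ℕ∞) (h : i ≤ l) :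
    dropGap l m i = m (l + 1) - (l + 1 - i : ℕ) := by
  rw [dropGap, max_eq_right (by omega)]

namespace IsFirstGap

variable {m : ℕ → ℕ∞} {l x : ℕ}

/-- The subtraction in `dropGap` does not truncate, since `m (l + 1) > x + l + 1`. -/
theorem natCast_le_dropGap_iff (h : IsFirstGap m l x) {i : ℕ} (hi : i ≤ l) (k : ℕ) :
    (k : ℕ∞) ≤ dropGap l m i ↔ ((k + (l + 1 - i) : ℕ) : ℕ∞) ≤ m (l + 1) := by
  rw [dropGap_of_le m hi]
  rcases eq_or_ne (m (l + 1)) ⊤ with ht | ht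
  · rw [ht, ENat.top_sub_natCast]
    exact iff_of_true le_top le_top
  · obtain ⟨y, hy⟩ := ENat.ne_top_iff_exists.mp ht
    have := h.lt
    rw [← hy] at this ⊢
    norm_cast at this ⊢
    omega

/-- The modified entries exceed the original ones, so the minimum with the heights `x + i` of the
cyclic summand gives back `m`. -/
theorem lt_dropGap (h : IsFirstGap m l x) {i : ℕ} (hi : i ≤ l) :
    ((x + i : ℕ) : ℕ∞) < dropGap l m i := by
  have : ((x + i + 1 : ℕ) : ℕ∞) ≤ dropGap l m i := by
    rw [h.natCast_le_dropGap_iff hi]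
    have := Order.add_one_le_of_lt h.lt
    rw [show x + i + 1 + (l + 1 - i) = x + l + 1 + 1 by omega]
    exact_mod_cast this
  exact lt_of_lt_of_le (by exact_mod_cast Nat.lt_succ_self _) this

/-- Below `l` neither sequence has a gap, and beyond `l` the two agree. Hence dropping the first gap
loses exactly one gap and creates none. -/
theorem gap_iff (h : IsFirstGap m l x) (i : ℕ) :
    m i + 1 < m (i + 1) ↔ i = l ∨ dropGap l m i + 1 < dropGap l m (i + 1) := by
  rcases lt_trichotomy i l with hi | rfl | hi
  · rw [h.eq_add i hi.le, h.eq_add (i + 1) hi, dropGap_of_le m hi.le, dropGap_of_le m hi]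
    have h1 : ¬ (((x + i : ℕ) : ℕ∞) + 1 < (x + (i + 1) : ℕ)) := by
      norm_cast; omega
    have h2 : ¬ (m (l + 1) - (l + 1 - i : ℕ) + 1 < m (l + 1) - (l + 1 - (i + 1) : ℕ)) := by
      rcases eq_or_ne (m (l + 1)) ⊤ with ht | ht
      · simp [ht]
      · obtain ⟨y, hy⟩ := ENat.ne_top_iff_exists.mp ht
        have := h.lt
        rw [← hy] at this ⊢
        norm_cast at this ⊢
        omega
    exact iff_of_false h1 (not_or_intro hi.ne h2)
  · simp only [true_or, iff_true]
    rw [h.eq_add i le_rfl]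
    exact_mod_cast h.lt
  · rw [dropGap_of_lt m hi, dropGap_of_lt m (by omega)]
    simp [hi.ne']

theorem not_gap_dropGap (h : IsFirstGap m l x) :
    ¬ dropGap l m l + 1 < dropGap l m (l + 1) := by
  rw [dropGap_of_le m le_rfl, dropGap_of_lt m (Nat.lt_succ_self l)]
  rcases eq_or_ne (m (l + 1)) ⊤ with ht | ht
  · simp [ht]
  · obtain ⟨y, hy⟩ := ENat.ne_top_iff_exists.mp ht
    have := h.lt
    rw [← hy] at this ⊢
    norm_cast at this ⊢
    omega

theorem dropGap_add_one_le (h : IsFirstGap m l x) (hm : ∀ i, m i + 1 ≤ m (i + 1)) (i : ℕ) :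
    dropGap l m i + 1 ≤ dropGap l m (i + 1) := by
  rcases lt_or_ge l i with hi | hi
  · rw [dropGap_of_lt m hi, dropGap_of_lt m (by omega)]
    exact hm i
  · refine ENat.forall_natCast_le_iff_le.mp fun k hk => ?_
    cases k with
    | zero => exact zero_le
    | succ k =>
      rw [Nat.cast_add_one, ENat.add_le_add_iff_right ENat.one_ne_top,
        h.natCast_le_dropGap_iff hi] at hk
      rcases hi.lt_or_eq with hi | rfl
      · rw [h.natCast_le_dropGap_iff hi]
        rwa [show k + 1 + (l + 1 - (i + 1)) = k + (l + 1 - i) by omega]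
      · rw [dropGap_of_lt m (Nat.lt_succ_self i)]
        rwa [show k + (i + 1 - i) = k + 1 by omega] at hk

end IsFirstGap

/-- There is no gap after an infinite entry. Finiteness makes the `Set.ncard` in `numGaps` a genuine
count. -/
theorem finite_gaps {m : ℕ → ℕ∞} (hm : ∀ i, m i + 1 ≤ m (i + 1)) (htop : ∃ i, m i = ⊤) :
    {i | m i + 1 < m (i + 1)}.Finite := by
  obtain ⟨n, hn⟩ := htop
  refine (Set.finite_lt_nat n).subset fun i hi => ?_
  by_contra hni
  have h := add_le_of_add_one_le hm n (i - n)
  rw [hn, top_add, Nat.add_sub_cancel' (not_lt.mp hni), top_le_iff] at h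
  rw [Set.mem_ofPred_eq, h, top_add] at hi
  exact not_top_lt hi

theorem IsFirstGap.numGaps_eq {m : ℕ → ℕ∞} {l x : ℕ} (h : IsFirstGap m l x)
    (hm : ∀ i, m i + 1 ≤ m (i + 1)) (htop : ∃ i, m i = ⊤) :
    numGaps m = numGaps (dropGap l m) + 1 := by
  have heq : {i | m i + 1 < m (i + 1)} =
      insert l {i | dropGap l m i + 1 < dropGap l m (i + 1)} := by
    ext i
    exact h.gap_iff i
  have hfin := finite_gaps hm htop
  rw [heq] at hfin
  have hl : l ∉ {i | dropGap l m i + 1 < dropGap l m (i + 1)} := h.not_gap_dropGap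
  rw [numGaps, heq, Set.ncard_insert_of_notMem hl (hfin.subset (Set.subset_insert _ _)), numGaps]

end Sequences

section CyclicModule

variable {Λ : Type u} [CommRing Λ] {p : Λ}

theorem heightSeq_mk_pow (x q i : ℕ) (h : q ≤ x + i) :
    heightSeq p (Ideal.Quotient.mk (Ideal.span {p ^ q}) (p ^ x)) i = ⊤ := by
  rw [heightSeq, Algebra.smul_def]
  change height p (Ideal.Quotient.mk _ (p ^ i) * Ideal.Quotient.mk _ (p ^ x)) = ⊤
  rw [← map_mul, ← pow_add, Ideal.Quotient.eq_zero_iff_mem.mpr, height_zero]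
  exact Ideal.mem_span_singleton.mpr (pow_dvd_pow _ (by omega))

end CyclicModule

/-! ### Pure elements and splitting off the first gap -/

section Splitting

variable {Λ : Type u} [CommRing Λ] [IsDomain Λ] [IsDiscreteValuationRing Λ] {p : Λ}
variable {M : Type u} [AddCommGroup M] [Module Λ M]

theorem eq_unit_mul_pow_or_eq_zero (hp : Irreducible p) (c : Λ) :
    c = 0 ∨ ∃ (n : ℕ) (u : Λˣ), c = u * p ^ n :=
  or_iff_not_imp_left.mpr fun h => IsDiscreteValuationRing.eq_unit_mul_pow_irreducible h hp

/-- An element which generates a pure submodule of order `p ^ (q + 1)`. -/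
structure IsPureElement (p : Λ) (e : M) (q : ℕ) : Prop where
  pow_succ_smul : p ^ (q + 1) • e = 0
  notMem : p ^ q • e ∉ p ^ (q + 1) • (⊤ : Submodule Λ M)

theorem IsPureElement.smul_eq_zero_iff (hp : Irreducible p) {e : M} {q : ℕ}
    (he : IsPureElement p e q) (c : Λ) : c • e = 0 ↔ p ^ (q + 1) ∣ c := by
  constructor
  · intro h
    rcases eq_unit_mul_pow_or_eq_zero hp c with rfl | ⟨n, u, rfl⟩
    · exact dvd_zero _
    rw [mul_smul, u.isUnit.smul_eq_zero] at h
    refine Dvd.dvd.mul_left (pow_dvd_pow _ ?_) _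
    by_contra hn
    apply he.notMem
    have hq : p ^ q • e = p ^ (q - n) • p ^ n • e := by
      rw [smul_smul, ← pow_add, Nat.sub_add_cancel (by omega)]
    rw [hq, h, smul_zero]
    exact zero_mem _
  · rintro ⟨d, rfl⟩
    rw [mul_comm, mul_smul, he.pow_succ_smul, smul_zero]

theorem IsPureElement.smul_mem_pow_smul_top_iff (hp : Irreducible p) {e : M} {q : ℕ}
    (he : IsPureElement p e q) (c : Λ) :
    c • e ∈ p ^ (q + 1) • (⊤ : Submodule Λ M) ↔ c • e = 0 := by
  refine ⟨fun h => ?_, fun h => h ▸ zero_mem _⟩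
  rcases eq_unit_mul_pow_or_eq_zero hp c with rfl | ⟨n, u, rfl⟩
  · rw [zero_smul]
  rw [he.smul_eq_zero_iff hp]
  refine Dvd.dvd.mul_left (pow_dvd_pow _ ?_) _
  by_contra hn
  apply he.notMem
  rw [mul_smul, Submodule.smul_mem_iff_of_isUnit _ u.isUnit] at h
  have hq : p ^ q • e = p ^ (q - n) • p ^ n • e := by
    rw [smul_smul, ← pow_add, Nat.sub_add_cancel (by omega)]
  rw [hq]
  exact Submodule.smul_mem _ _ h

/-- Take `K` maximal among the submodules that contain `pᵠ⁺¹M` and meet `(e)` trivially. Then `(e) +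
K` is closed under division by `p`; as it contains `pᵠ⁺¹M`, it is everything. -/
theorem IsPureElement.exists_isCompl (hp : Irreducible p) [IsNoetherian Λ M] {e : M} {q : ℕ}
    (he : IsPureElement p e q) : ∃ K : Submodule Λ M, IsCompl (Submodule.span Λ {e}) K := by
  have hdisj : Disjoint (Submodule.span Λ {e}) (p ^ (q + 1) • (⊤ : Submodule Λ M)) := by
    rw [Submodule.disjoint_def]
    intro x hx hx'
    obtain ⟨c, rfl⟩ := Submodule.mem_span_singleton.mp hx
    exact (he.smul_mem_pow_smul_top_iff hp c).mp hx'
  obtain ⟨K, ⟨hK1, hK2⟩, hmax⟩ := exists_maximal_of_wellFoundedGT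
    (fun K : Submodule Λ M => p ^ (q + 1) • ⊤ ≤ K ∧ Disjoint (Submodule.span Λ {e}) K)
    ⟨_, le_rfl, hdisj⟩
  have hstep : ∀ x : M, p • x ∈ Submodule.span Λ {e} ⊔ K → x ∈ Submodule.span Λ {e} ⊔ K := by
    intro x hx
    obtain ⟨_, hse, k, hk, hsum⟩ := Submodule.mem_sup.mp hx
    obtain ⟨s, rfl⟩ := Submodule.mem_span_singleton.mp hse
    have hs : (p ^ q * s) • e = 0 := by
      refine (Submodule.disjoint_def.mp hK2) _
        (Submodule.smul_mem _ _ (Submodule.mem_span_singleton_self e)) ?_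
      have h1 : p ^ (q + 1) • x ∈ K := hK1 (mem_pow_smul_top.mpr ⟨x, rfl⟩)
      have h2 : (p ^ q * s) • e = p ^ (q + 1) • x - p ^ q • k := by
        rw [pow_succ, mul_smul, mul_smul, ← hsum, smul_add, add_sub_cancel_right]
      rw [h2]
      exact sub_mem h1 (Submodule.smul_mem _ _ hk)
    -- Purity makes `s = p t`, so `x` may be replaced by `y = x - t e`, for which `p y ∈ K`.
    rw [he.smul_eq_zero_iff hp, pow_succ] at hs
    obtain ⟨t, rfl⟩ := (mul_dvd_mul_iff_left (pow_ne_zero q hp.ne_zero)).mp hs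
    have hy : p • (x - t • e) ∈ K := by
      rw [smul_sub, ← hsum, smul_smul, add_sub_cancel_left]
      exact hk
    have hxy : x = t • e + (x - t • e) := by abel
    generalize x - t • e = y at hy hxy
    have hte : t • e ∈ Submodule.span Λ {e} ⊔ K :=
      Submodule.mem_sup_left (Submodule.smul_mem _ _ (Submodule.mem_span_singleton_self e))
    rw [hxy]
    refine add_mem hte ?_
    by_contra hyn
    have hyK : y ∉ K := fun h => hyn (Submodule.mem_sup_right h)
    -- If `y ∉ (e) + K`, then `K + (y)` still meets `(e)` trivially, against maximality: `c y` is in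
    -- `K` when `p ∣ c`, while a unit `c` would put `y` into `(e) + K`.
    refine hyK (hmax (y := K ⊔ Submodule.span Λ {y}) ⟨hK1.trans le_sup_left, ?_⟩ le_sup_left
      (Submodule.mem_sup_right (Submodule.mem_span_singleton_self y)))
    rw [Submodule.disjoint_def]
    intro z hz hz'
    obtain ⟨k', hk', _, hcy, rfl⟩ := Submodule.mem_sup.mp hz'
    obtain ⟨c, rfl⟩ := Submodule.mem_span_singleton.mp hcy
    rcases dvd_or_isUnit hp c with ⟨d, rfl⟩ | hc
    · refine (Submodule.disjoint_def.mp hK2) _ hz (add_mem hk' ?_)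
      rw [mul_comm, mul_smul]
      exact Submodule.smul_mem _ _ hy
    · refine absurd ?_ hyn
      rw [← Submodule.smul_mem_iff_of_isUnit _ hc]
      have := sub_mem (Submodule.mem_sup_left (T := K) hz) (Submodule.mem_sup_right hk')
      rwa [add_sub_cancel_left] at this
  refine ⟨K, hK2, ?_⟩
  rw [codisjoint_iff, eq_top_iff]
  rintro x -
  have hpow : ∀ n (x : M), p ^ n • x ∈ Submodule.span Λ {e} ⊔ K →
      x ∈ Submodule.span Λ {e} ⊔ K := by
    intro n
    induction n with
    | zero => intro x hx; simpa using hx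
    | succ n ih =>
      intro x hx
      rw [pow_succ, mul_smul] at hx
      exact hstep x (ih _ hx)
  exact hpow (q + 1) x (Submodule.mem_sup_right (hK1 (mem_pow_smul_top.mpr ⟨x, rfl⟩)))

theorem IsPureElement.exists_equiv (hp : Irreducible p) [IsNoetherian Λ M] {e : M} {q : ℕ}
    (he : IsPureElement p e q) : ∃ (K : Submodule Λ M)
      (f : M ≃ₗ[Λ] (Λ ⧸ Ideal.span {p ^ (q + 1)}) × K), f e = (1, 0) := by
  obtain ⟨K, hK⟩ := he.exists_isCompl hp
  have htor : Ideal.span {p ^ (q + 1)} = Ideal.torsionOf Λ M e := by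
    ext c
    rw [Ideal.mem_torsionOf_iff, he.smul_eq_zero_iff hp, Ideal.mem_span_singleton]
  let g : (Λ ⧸ Ideal.span {p ^ (q + 1)}) ≃ₗ[Λ] Submodule.span Λ {e} :=
    (Submodule.quotEquivOfEq _ _ htor).trans (Ideal.quotTorsionOfEquivSpanSingleton Λ M e)
  have hg : (g 1 : M) = e := by
    change ((1 : Λ) • e : M) = e
    exact one_smul _ _
  let F := (g.prodCongr (LinearEquiv.refl Λ K)).trans (Submodule.prodEquivOfIsCompl _ _ hK)
  refine ⟨K, F.symm, ?_⟩
  rw [LinearEquiv.symm_apply_eq]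
  change e = ((g 1 : M) + ((0 : K) : M))
  rw [hg, ZeroMemClass.coe_zero, add_zero]

theorem heightSeq_mk_pow_of_lt (hp : Irreducible p) (x q i : ℕ) (h : x + i < q) :
    heightSeq p (Ideal.Quotient.mk (Ideal.span {p ^ q}) (p ^ x)) i = (x + i : ℕ) := by
  refine ENat.eq_of_forall_natCast_le_iff fun k => ?_
  rw [heightSeq, Algebra.smul_def]
  change _ ≤ height p (Ideal.Quotient.mk _ (p ^ i) * Ideal.Quotient.mk _ (p ^ x)) ↔ _
  rw [← map_mul, ← pow_add, natCast_le_height_iff, mem_pow_smul_top, Nat.cast_le]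
  constructor
  · rintro ⟨y, hy⟩
    by_contra hk
    have h1 : Ideal.Quotient.mk (Ideal.span {p ^ q}) (p ^ (q - 1)) = 0 := by
      rw [show q - 1 = (q - 1 - (i + x)) + (i + x) by omega, pow_add, map_mul, ← hy,
        mul_smul_comm]
      obtain ⟨z, rfl⟩ := Ideal.Quotient.mk_surjective y
      rw [← map_mul, Algebra.smul_def]
      change Ideal.Quotient.mk _ (p ^ k) * Ideal.Quotient.mk _ _ = 0
      rw [← map_mul, Ideal.Quotient.eq_zero_iff_mem, Ideal.mem_span_singleton, ← mul_assoc,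
        ← pow_add]
      exact Dvd.dvd.mul_right (pow_dvd_pow _ (by omega)) _
    rw [mk_pow_eq_zero_iff hp] at h1
    omega
  · intro hk
    refine ⟨Ideal.Quotient.mk _ (p ^ (i + x - k)), ?_⟩
    rw [Algebra.smul_def]
    change Ideal.Quotient.mk _ (p ^ k) * Ideal.Quotient.mk _ _ = _
    rw [← map_mul, ← pow_add, Nat.add_sub_cancel' (by omega)]

/-- The gap allows `pˡ⁺¹a` to be divided by one more power of `p` than `pˣ⁺ˡ⁺¹`. The quotient `c` is
chosen as divisible as possible, which later gives the lower bound for the heights in the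
complement. -/
theorem IsFirstGap.exists_pow_smul {a : M} {l x : ℕ} [IsNoetherian Λ M] [IsArtinian Λ M]
    (hp : Irreducible p) (h : IsFirstGap (heightSeq p a) l x) :
    ∃ c : M, p ^ (l + 1) • a = p ^ (x + l + 2) • c ∧
      ∀ k : ℕ, ((k + (x + l + 2) : ℕ) : ℕ∞) ≤ heightSeq p a (l + 1) →
        c ∈ p ^ k • (⊤ : Submodule Λ M) := by
  rcases eq_or_ne (heightSeq p a (l + 1)) ⊤ with ht | ht
  · refine ⟨0, ?_, fun k _ => zero_mem _⟩
    obtain ⟨n, hn⟩ := exists_pow_smul_eq_zero (M := M) hp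
    have : (n : ℕ∞) ≤ heightSeq p a (l + 1) := by rw [ht]; exact le_top
    obtain ⟨y, hy⟩ := mem_pow_smul_top.mp (natCast_le_height_iff.mp this)
    rw [← hy, hn, smul_zero]
  · obtain ⟨y, hy⟩ := ENat.ne_top_iff_exists.mp ht
    have hlt := h.lt
    obtain ⟨d, hd⟩ := mem_pow_smul_top.mp (natCast_le_height_iff.mp hy.le)
    rw [← hy] at hlt ⊢
    norm_cast at hlt
    refine ⟨p ^ (y - (x + l + 2)) • d, ?_, fun k hk => ?_⟩
    · rw [smul_smul, ← pow_add, Nat.add_sub_cancel' (by omega), hd]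
    · norm_cast at hk
      exact pow_smul_mem_pow_smul_top (by omega) d

theorem IsFirstGap.exists_equiv (hp : Irreducible p) [IsNoetherian Λ M] [IsArtinian Λ M]
    {a : M} {l x : ℕ} (h : IsFirstGap (heightSeq p a) l x) :
    ∃ (K : Submodule Λ M) (f : M ≃ₗ[Λ] (Λ ⧸ Ideal.span {p ^ (x + l + 1)}) × K) (a' : K),
      f a = (Ideal.Quotient.mk _ (p ^ x), a') ∧
        heightSeq p a' = dropGap l (heightSeq p a) := by
  obtain ⟨c, hc, hcmem⟩ := h.exists_pow_smul hp
  have hx : (x : ℕ∞) ≤ height p a := by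
    have := h.eq_add 0 (Nat.zero_le _)
    rw [heightSeq, pow_zero, one_smul] at this
    rw [this, add_zero]
  obtain ⟨b, hb⟩ := mem_pow_smul_top.mp (natCast_le_height_iff.mp hx)
  -- With `a = pˣb`, the corrected element `b - p c` is killed by `pˣ⁺ˡ⁺¹`. It is pure because
  -- `pˣ⁺ˡ(b - p c)` differs from `pˡa`, of height exactly `x + l`, by an element of `pˣ⁺ˡ⁺¹M`.
  have he : IsPureElement p (b - p • c) (x + l) := by
    constructor
    · rw [smul_sub, show x + l + 1 = (l + 1) + x by omega, pow_add, mul_smul, hb, hc, smul_smul,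
        ← pow_add, ← pow_succ, show l + 1 + x + 1 = x + l + 2 by omega, sub_self]
    · intro hmem
      have h1 : p ^ l • a = p ^ (x + l) • (b - p • c) + p ^ (x + l + 1) • c := by
        rw [smul_sub, smul_smul, ← pow_succ, sub_add_cancel, add_comm x l, pow_add, mul_smul, hb]
      have h2 : p ^ l • a ∈ p ^ (x + l + 1) • (⊤ : Submodule Λ M) := by
        rw [h1]
        exact add_mem hmem (mem_pow_smul_top.mpr ⟨c, rfl⟩)
      have h3 := h.eq_add l le_rfl
      rw [← natCast_le_height_iff, ← heightSeq, h3] at h2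
      norm_cast at h2
      omega
  obtain ⟨K, f, hf⟩ := he.exists_equiv hp
  obtain ⟨s, hs⟩ := Ideal.Quotient.mk_surjective (f c).1
  obtain ⟨u, hu⟩ := isUnit_one_add_mul hp s
  -- Since `a = pˣ(b - p c) + pˣ⁺¹c`, its first component is `pˣ(1 + p s)`; rescaling by the unit `u
  -- = 1 + p s` normalizes it to `pˣ`.
  let f' := f.trans ((LinearEquiv.smulOfUnit u⁻¹).prodCongr (LinearEquiv.refl Λ K))
  have hfa : f' a = (Ideal.Quotient.mk _ (p ^ x), p ^ (x + 1) • (f c).2) := by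
    have h1 : f a = (p ^ x • ((u : Λ) • 1), p ^ (x + 1) • (f c).2) := by
      have : a = p ^ x • (b - p • c) + p ^ (x + 1) • c := by
        rw [smul_sub, hb, smul_smul, ← pow_succ, sub_add_cancel]
      conv_lhs => rw [this]
      rw [map_add, map_smul, map_smul, hf]
      ext1
      · simp only [Prod.fst_add, Prod.smul_fst, ← hs, hu, Algebra.smul_def]
        change Ideal.Quotient.mk _ (p ^ x) * 1 +
          Ideal.Quotient.mk _ (p ^ (x + 1)) * Ideal.Quotient.mk _ s =
          Ideal.Quotient.mk _ (p ^ x) * (Ideal.Quotient.mk _ (1 + p * s) * 1)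
        simp only [← map_one (Ideal.Quotient.mk (Ideal.span {p ^ (x + l + 1)})), ← map_mul,
          ← map_add]
        ring_nf
      · simp
    change (u⁻¹ • (f a).1, (f a).2) = _
    rw [h1]
    simp only [Prod.mk.injEq, and_true]
    rw [smul_comm (p ^ x) (u : Λ), ← Units.smul_def, inv_smul_smul, pow_smul_mk_one]
  refine ⟨K, f', p ^ (x + 1) • (f c).2, hfa, ?_⟩
  -- Beyond index `l` the cyclic component is killed and imposes no bound on the height.
  have hgt : ∀ i, l < i →
      heightSeq p (p ^ (x + 1) • (f c).2) i = heightSeq p a i := by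
    intro i hi
    rw [← heightSeq_congr f' a, hfa, heightSeq_prod, heightSeq_mk_pow _ _ _ (by omega),
      min_eq_right le_top]
  funext i
  rcases lt_or_ge l i with hi | hi
  · rw [dropGap_of_lt _ hi, hgt i hi]
  · refine ENat.eq_of_forall_natCast_le_iff fun k => ?_
    rw [h.natCast_le_dropGap_iff hi]
    -- Up to index `l`, the upper bound comes from growth of heights up to index `l + 1`, the lower
    -- bound from the divisibility of `c`.
    constructor
    · intro hk
      have h1 := add_le_of_add_one_le (heightSeq_add_one_le (p := p) (p ^ (x + 1) • (f c).2))
        i (l + 1 - i)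
      rw [Nat.add_sub_cancel' (by omega), hgt (l + 1) (by omega)] at h1
      refine le_trans ?_ h1
      rw [Nat.cast_add]
      exact add_le_add_left hk _
    · intro hk
      rw [heightSeq, natCast_le_height_iff, smul_smul, ← pow_add]
      rcases le_total k (i + (x + 1)) with hki | hki
      · exact pow_smul_mem_pow_smul_top hki _
      · have hcm := hcmem (k - (i + (x + 1))) (by
          rwa [show k - (i + (x + 1)) + (x + l + 2) = k + (l + 1 - i) by omega])
        obtain ⟨z, rfl⟩ := mem_pow_smul_top.mp hcm
        rw [map_smul, Prod.smul_snd, smul_smul, ← pow_add]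
        exact pow_smul_mem_pow_smul_top (by omega) _

end Splitting

/-! ### Young diagrams described by row lengths -/

section YoungDiagram

theorem exists_youngDiagram {ρ : ℕ → ℕ} (hρ : Antitone ρ) (h0 : ∃ n, ρ n = 0) :
    ∃ β : YoungDiagram, ∀ k, β.rowLen k = ρ k := by
  obtain ⟨n, hn⟩ := h0
  let β : YoungDiagram :=
    { cells := (Finset.range n ×ˢ Finset.range (ρ 0)).filter fun c => c.2 < ρ c.1
      isLowerSet := by
        rintro ⟨i, j⟩ ⟨i', j'⟩ ⟨h1, h2⟩ h
        simp only [Finset.coe_filter, Finset.mem_product, Finset.mem_range, Set.mem_ofPred_eq]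
          at h h1 h2 ⊢
        have := hρ h1
        omega }
  refine ⟨β, fun k => ?_⟩
  have hmem : ∀ j, j < β.rowLen k ↔ j < ρ k := by
    intro j
    rw [← YoungDiagram.mem_iff_lt_rowLen, ← YoungDiagram.mem_cells]
    simp only [β, Finset.mem_filter, Finset.mem_product, Finset.mem_range]
    refine ⟨fun h => h.2, fun h => ⟨⟨?_, h.trans_le (hρ (Nat.zero_le k))⟩, h⟩⟩
    by_contra hk
    have := hρ (not_lt.mp hk)
    omega
  exact le_antisymm (le_of_forall_lt fun j => (hmem j).mp) (le_of_forall_lt fun j => (hmem j).mpr)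

theorem YoungDiagram.eq_of_rowLen_eq {β γ : YoungDiagram} (h : ∀ k, β.rowLen k = γ.rowLen k) :
    β = γ := by
  ext ⟨i, j⟩
  rw [YoungDiagram.mem_cells, YoungDiagram.mem_cells, YoungDiagram.mem_iff_lt_rowLen,
    YoungDiagram.mem_iff_lt_rowLen, h]

theorem YoungDiagram.sum_colLen_sub (β : YoungDiagram) (k : ℕ) :
    ∑ j : Fin (β.rowLen 0), (β.colLen j - k) =
      ∑ j : Fin (β.rowLen 0), (β.colLen j - (k + 1)) + β.rowLen k := by
  have h1 : ∀ j, β.colLen j - k = (β.colLen j - (k + 1)) + if j < β.rowLen k then 1 else 0 := by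
    intro j
    have : j < β.rowLen k ↔ k < β.colLen j := by
      rw [← YoungDiagram.mem_iff_lt_rowLen, YoungDiagram.mem_iff_lt_colLen]
    split_ifs <;> omega
  rw [← Finset.sum_range fun j => β.colLen j - k,
    ← Finset.sum_range fun j => β.colLen j - (k + 1), Finset.sum_congr rfl fun j _ => h1 j,
    Finset.sum_add_distrib, ← Finset.card_filter]
  congr 1
  have : (Finset.range (β.rowLen 0)).filter (· < β.rowLen k) = Finset.range (β.rowLen k) := by
    ext j
    have := β.rowLen_anti 0 k (Nat.zero_le k)
    simp only [Finset.mem_filter, Finset.mem_range]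
    omega
  rw [this, Finset.card_range]

end YoungDiagram

theorem eq_top_of_le {m : ℕ → ℕ∞} (hm : ∀ i, m i + 1 ≤ m (i + 1)) {n : ℕ}
    (h : m n = ⊤) {i : ℕ} (hi : n ≤ i) : m i = ⊤ := by
  have := add_le_of_add_one_le hm n (i - n)
  rwa [h, top_add, Nat.add_sub_cancel' hi, top_le_iff] at this

/-! ### Row lengths of a module -/

section PowLength

variable {Λ : Type u} [CommRing Λ] {p : Λ}
variable {M : Type u} [AddCommGroup M] [Module Λ M]
variable {N : Type u} [AddCommGroup N] [Module Λ N]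

/-- The length of `pᵏM / pᵏ⁺¹M` is `ρ k`. -/
def HasRows (p : Λ) (M : Type u) [AddCommGroup M] [Module Λ M] (ρ : ℕ → ℕ) : Prop :=
  ∀ k, powLength p M k = powLength p M (k + 1) + ρ k

theorem powLength_anti [IsNoetherian Λ M] [IsArtinian Λ M] : Antitone (powLength p M) := by
  intro k l h
  have := Module.length_le_of_injective _ (Submodule.inclusion_injective
    (pow_smul_top_anti (M := M) (p := p) h))
  rw [← coe_powLength, ← coe_powLength] at this
  exact_mod_cast this

theorem powLength_eq_zero_iff [IsNoetherian Λ M] [IsArtinian Λ M] {k : ℕ} :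
    powLength p M k = 0 ↔ p ^ k • (⊤ : Submodule Λ M) = ⊥ := by
  rw [← Nat.cast_eq_zero (R := ℕ∞), coe_powLength, Module.length_eq_zero_iff,
    Submodule.subsingleton_iff_eq_bot]

theorem powLength_zero_eq_zero_iff [IsNoetherian Λ M] [IsArtinian Λ M] :
    powLength p M 0 = 0 ↔ Subsingleton M := by
  rw [powLength_eq_zero_iff, pow_zero, one_smul, eq_comm, subsingleton_iff_bot_eq_top,
    Submodule.subsingleton_iff]

theorem HasRows.unique {ρ ρ' : ℕ → ℕ} (h : HasRows p M ρ) (h' : HasRows p M ρ') : ρ = ρ' := by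
  funext k
  have := h k
  have := h' k
  omega

theorem HasRows.congr {ρ : ℕ → ℕ} (h : HasRows p M ρ) (f : M ≃ₗ[Λ] N) : HasRows p N ρ := by
  intro k
  rw [← powLength_congr f, ← powLength_congr f, h k]

/-- When `pᵠ⁺¹M = 0`, any `e` with `pᵠe ≠ 0` is pure. -/
theorem exists_isPureElement [IsNoetherian Λ M] [IsArtinian Λ M] {q : ℕ}
    (h0 : powLength p M (q + 1) = 0) (h1 : powLength p M q ≠ 0) :
    ∃ e : M, IsPureElement p e q := by
  rw [powLength_eq_zero_iff] at h0
  rw [Ne, powLength_eq_zero_iff, ← Ne, Submodule.ne_bot_iff] at h1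
  obtain ⟨x, hx, hx0⟩ := h1
  obtain ⟨e, rfl⟩ := mem_pow_smul_top.mp hx
  refine ⟨e, ?_, ?_⟩
  · have : p ^ (q + 1) • e ∈ p ^ (q + 1) • (⊤ : Submodule Λ M) := mem_pow_smul_top.mpr ⟨e, rfl⟩
    simpa [h0] using this
  · simpa [h0] using hx0

end PowLength

/-! ### Classification and construction of pairs `(M, a)` -/

section Rows

variable {Λ : Type u} [CommRing Λ] [IsDomain Λ] [IsDiscreteValuationRing Λ] {p : Λ}
variable {M : Type u} [AddCommGroup M] [Module Λ M]
variable {N : Type u} [AddCommGroup N] [Module Λ N]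

theorem exists_powLength_eq_zero (hp : Irreducible p) [IsNoetherian Λ M] [IsArtinian Λ M] :
    ∃ n, powLength p M n = 0 := by
  obtain ⟨n, hn⟩ := exists_pow_smul_top_eq_bot (M := M) hp
  exact ⟨n, powLength_eq_zero_iff.mpr hn⟩

/-- Both length functions vanish for large `k`, so equal differences force equal values by descent.
-/
theorem HasRows.powLength_eq (hp : Irreducible p) [IsNoetherian Λ M] [IsArtinian Λ M]
    [IsNoetherian Λ N] [IsArtinian Λ N] {ρ : ℕ → ℕ} (hM : HasRows p M ρ) (hN : HasRows p N ρ)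
    (k : ℕ) : powLength p M k = powLength p N k := by
  obtain ⟨m, hm⟩ := exists_powLength_eq_zero (M := M) hp
  obtain ⟨n, hn⟩ := exists_powLength_eq_zero (M := N) hp
  have key : ∀ j k, m + n ≤ k + j → powLength p M k = powLength p N k := by
    intro j
    induction j with
    | zero =>
      intro k hk
      have h1 := powLength_anti (p := p) (M := M) (show m ≤ k by omega)
      have h2 := powLength_anti (p := p) (M := N) (show n ≤ k by omega)
      omega
    | succ j ih =>
      intro k hk
      rw [hM k, hN k, ih (k + 1) (by omega)]
  exact key (m + n) k (by omega)

theorem exists_powLength_succ_eq_zero (hp : Irreducible p) [IsNoetherian Λ M] [IsArtinian Λ M]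
    [Nontrivial M] : ∃ q, powLength p M (q + 1) = 0 ∧ powLength p M q ≠ 0 := by
  classical
  have h := exists_powLength_eq_zero (M := M) hp
  have h0 : Nat.find h ≠ 0 := by
    intro h0
    have := Nat.find_spec h
    rw [h0, powLength_zero_eq_zero_iff] at this
    exact not_subsingleton M this
  refine ⟨Nat.find h - 1, ?_, Nat.find_min h (by omega)⟩
  rw [Nat.sub_add_cancel (by omega)]
  exact Nat.find_spec h

theorem powLength_eq_of_equiv (hp : Irreducible p) [IsNoetherian Λ N] [IsArtinian Λ N] {n : ℕ}
    (f : M ≃ₗ[Λ] (Λ ⧸ Ideal.span {p ^ n}) × N) (k : ℕ) :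
    powLength p M k = (n - k) + powLength p N k := by
  have := isArtinian_quotient hp n
  rw [powLength_congr f, powLength_prod, powLength_quotient hp]

theorem heightSeq_eventually_top (hp : Irreducible p) [IsNoetherian Λ M] [IsArtinian Λ M] (a : M) :
    ∃ i, heightSeq p a i = ⊤ := by
  obtain ⟨n, hn⟩ := exists_pow_smul_eq_zero (M := M) hp
  exact ⟨n, by rw [heightSeq, hn, height_zero]⟩

theorem height_eq_top_iff (hp : Irreducible p) [IsNoetherian Λ M] [IsArtinian Λ M] {x : M} :
    height p x = ⊤ ↔ x = 0 := by
  refine ⟨fun h => ?_, fun h => h ▸ height_zero⟩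
  obtain ⟨n, hn⟩ := exists_pow_smul_eq_zero (M := M) hp
  have : (n : ℕ∞) ≤ height p x := by rw [h]; exact le_top
  obtain ⟨y, rfl⟩ := mem_pow_smul_top.mp (natCast_le_height_iff.mp this)
  exact hn y

theorem heightSeq_zero_eq_top_iff (hp : Irreducible p) [IsNoetherian Λ M] [IsArtinian Λ M]
    {x : M} : heightSeq p x 0 = ⊤ ↔ x = 0 := by
  rw [heightSeq, pow_zero, one_smul, height_eq_top_iff hp]

/-- The rows of `M` and the height sequence of `a` determine the pair `(M, a)` up to isomorphism. -/
theorem exists_equiv_of_heightSeq_eq (hp : Irreducible p) (n : ℕ) :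
    ∀ (M N : Type u) [AddCommGroup M] [Module Λ M] [AddCommGroup N] [Module Λ N]
      [IsNoetherian Λ M] [IsArtinian Λ M] [IsNoetherian Λ N] [IsArtinian Λ N] (a : M) (b : N),
      powLength p M 0 = n → (∀ k, powLength p M k = powLength p N k) →
      heightSeq p a = heightSeq p b → ∃ f : M ≃ₗ[Λ] N, f a = b := by
  induction n using Nat.strong_induction_on with
  | _ n ih =>
  intro M N _ _ _ _ _ _ _ _ a b hn hMN hab
  -- A common cyclic summand in which both elements have the same component can be cancelled by the
  -- induction hypothesis.
  have step : ∀ (q : ℕ) (K : Submodule Λ M) (K' : Submodule Λ N)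
      (f : M ≃ₗ[Λ] (Λ ⧸ Ideal.span {p ^ (q + 1)}) × K)
      (g : N ≃ₗ[Λ] (Λ ⧸ Ideal.span {p ^ (q + 1)}) × K') (t : Λ ⧸ Ideal.span {p ^ (q + 1)})
      (a' : K) (b' : K'), f a = (t, a') → g b = (t, b') → heightSeq p a' = heightSeq p b' →
      ∃ f : M ≃ₗ[Λ] N, f a = b := by
    intro q K K' f g t a' b' hf hg h
    have h1 := powLength_eq_of_equiv hp f
    have h2 := powLength_eq_of_equiv hp g
    obtain ⟨F, hF⟩ := ih (powLength p K 0) (by have := h1 0; omega) K K' a' b' rfl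
      (fun k => by have := h1 k; have := h2 k; have := hMN k; omega) h
    refine ⟨f.trans (((LinearEquiv.refl Λ _).prodCongr F).trans g.symm), ?_⟩
    rw [LinearEquiv.trans_apply, LinearEquiv.trans_apply, LinearEquiv.symm_apply_eq, hf, hg]
    exact Prod.ext rfl hF
  by_cases h0 : heightSeq p a 0 = ⊤
  · have ha := (heightSeq_zero_eq_top_iff hp).mp h0
    rw [hab, heightSeq_zero_eq_top_iff hp] at h0
    subst ha h0
    rcases subsingleton_or_nontrivial M with hM | hM
    · have hN : Subsingleton N := by
        rw [← powLength_zero_eq_zero_iff (Λ := Λ) (p := p)] at hM ⊢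
        rw [← hMN, hM]
      exact ⟨0, Subsingleton.elim _ _⟩
    · obtain ⟨q, hq1, hq0⟩ := exists_powLength_succ_eq_zero (M := M) hp
      obtain ⟨e, he⟩ := exists_isPureElement hq1 hq0
      rw [hMN] at hq0 hq1
      obtain ⟨e', he'⟩ := exists_isPureElement hq1 hq0
      obtain ⟨K, f, -⟩ := he.exists_equiv hp
      obtain ⟨K', g, -⟩ := he'.exists_equiv hp
      refine step q K K' f g 0 0 0 (map_zero f) (map_zero g) ?_
      funext i
      rw [heightSeq_zero, heightSeq_zero]
  -- The pair `(l, x)` depends only on the height sequence, so `M` and `N` split off the same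
  -- summand with the same component `pˣ`.
  · obtain ⟨l, x, h⟩ := exists_isFirstGap (heightSeq_add_one_le a)
      (heightSeq_eventually_top hp a) h0
    obtain ⟨K, f, a', hf, ha'⟩ := h.exists_equiv hp
    obtain ⟨K', g, b', hg, hb'⟩ := (hab ▸ h).exists_equiv hp
    exact step (x + l) K K' f g _ a' b' hf hg (by rw [ha', hb', hab])

/-- Each cyclic summand contributes a truncated difference `n - k`, which is convex in `k`.
Convexity says that the row lengths decrease, as a Young diagram requires. -/
theorem powLength_convex (hp : Irreducible p) (n : ℕ) :
    ∀ (M : Type u) [AddCommGroup M] [Module Λ M] [IsNoetherian Λ M] [IsArtinian Λ M],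
      powLength p M 0 = n → ∀ k,
      2 * powLength p M (k + 1) ≤ powLength p M k + powLength p M (k + 2) := by
  induction n using Nat.strong_induction_on with
  | _ n ih =>
  intro M _ _ _ _ hn k
  rcases subsingleton_or_nontrivial M with hM | hM
  · rw [← powLength_zero_eq_zero_iff (Λ := Λ) (p := p)] at hM
    have := powLength_anti (p := p) (M := M) (Nat.zero_le (k + 1))
    omega
  · obtain ⟨q, hq1, hq0⟩ := exists_powLength_succ_eq_zero (M := M) hp
    obtain ⟨e, he⟩ := exists_isPureElement hq1 hq0
    obtain ⟨K, f, -⟩ := he.exists_equiv hp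
    have h := powLength_eq_of_equiv hp f
    have h0 := h 0
    have := ih (powLength p K 0) (by omega) K rfl k
    have := h k
    have := h (k + 1)
    have := h (k + 2)
    omega

theorem exists_hasRows (hp : Irreducible p) [IsNoetherian Λ M] [IsArtinian Λ M] :
    ∃ β : YoungDiagram, HasRows p M β.rowLen := by
  have hanti := powLength_anti (p := p) (M := M)
  suffices h : ∃ β : YoungDiagram, ∀ k,
      β.rowLen k = powLength p M k - powLength p M (k + 1) by
    obtain ⟨β, hβ⟩ := h
    refine ⟨β, fun k => ?_⟩
    have := hanti (Nat.le_succ k)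
    rw [hβ]
    exact (Nat.add_sub_cancel' this).symm
  refine exists_youngDiagram ?_ ?_
  · refine antitone_nat_of_succ_le fun k => ?_
    have := powLength_convex hp _ M rfl k
    have : powLength p M (k + 1) ≤ powLength p M k := hanti (Nat.le_succ k)
    have : powLength p M (k + 2) ≤ powLength p M (k + 1) := hanti (Nat.le_succ (k + 1))
    rw [show k + 1 + 1 = k + 2 from rfl]
    omega
  · obtain ⟨n, hn⟩ := exists_powLength_eq_zero (M := M) hp
    exact ⟨n, by rw [hn, Nat.zero_sub]⟩

theorem powLength_pi (hp : Irreducible p) {n : ℕ} (c : Fin n → ℕ) (k : ℕ) :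
    powLength p ((j : Fin n) → Λ ⧸ Ideal.span {p ^ c j}) k = ∑ j, (c j - k) := by
  induction n with
  | zero =>
    have := powLength_anti (p := p) (M := (j : Fin 0) → Λ ⧸ Ideal.span {p ^ c j}) (Nat.zero_le k)
    rw [powLength_zero_eq_zero_iff.mpr inferInstance] at this
    simpa using this
  | succ n ih =>
    have := fun j : Fin n => isArtinian_quotient hp (c j.succ)
    rw [powLength_eq_of_equiv hp
      (Fin.consLinearEquiv Λ fun j => Λ ⧸ Ideal.span {p ^ c j}).symm, Fin.sum_univ_succ,
      ih fun j => c j.succ]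

theorem hasRows_pi (hp : Irreducible p) (β : YoungDiagram) :
    HasRows p ((j : Fin (β.rowLen 0)) → Λ ⧸ Ideal.span {p ^ β.colLen j}) β.rowLen := by
  intro k
  rw [powLength_pi hp fun j : Fin (β.rowLen 0) => β.colLen j,
    powLength_pi hp fun j : Fin (β.rowLen 0) => β.colLen j, β.sum_colLen_sub]

/-- The isomorphism comes from the classification of pairs, applied with both elements zero. -/
theorem hasPartition_iff (hp : Irreducible p) [IsNoetherian Λ M] [IsArtinian Λ M]
    (β : YoungDiagram) : HasPartition p M β ↔ HasRows p M β.rowLen := by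
  constructor
  · rintro ⟨f⟩
    exact (hasRows_pi hp β).congr f.symm
  · intro h
    have := fun j : Fin (β.rowLen 0) => isArtinian_quotient hp (β.colLen j)
    obtain ⟨f, -⟩ := exists_equiv_of_heightSeq_eq hp _ M
      ((j : Fin (β.rowLen 0)) → Λ ⧸ Ideal.span {p ^ β.colLen j}) 0 0 rfl
      (h.powLength_eq hp (hasRows_pi hp β)) (by funext i; rw [heightSeq_zero, heightSeq_zero])
    exact ⟨f⟩

/-- A summand with as many cyclic direct summands as there are gaps contains `a`. -/
theorem exists_equiv_prod_numGaps (hp : Irreducible p) (n : ℕ) :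
    ∀ (M : Type u) [AddCommGroup M] [Module Λ M] [IsNoetherian Λ M] [IsArtinian Λ M] (a : M),
      numGaps (heightSeq p a) = n →
      ∃ (U : Type u) (_ : AddCommGroup U) (_ : Module Λ U) (_ : IsNoetherian Λ U)
        (_ : IsArtinian Λ U) (V : Type u) (_ : AddCommGroup V) (_ : Module Λ V)
        (_ : IsNoetherian Λ V) (_ : IsArtinian Λ V) (f : M ≃ₗ[Λ] U × V) (u : U),
        f a = (u, 0) ∧ powLength p U 0 = powLength p U 1 + n := by
  induction n with
  | zero =>
    intro M _ _ _ _ a hn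
    have h0 : heightSeq p a 0 = ⊤ := by
      by_contra h0
      obtain ⟨l, x, h⟩ := exists_isFirstGap (heightSeq_add_one_le a)
        (heightSeq_eventually_top hp a) h0
      rw [h.numGaps_eq (heightSeq_add_one_le a) (heightSeq_eventually_top hp a)] at hn
      omega
    rw [heightSeq_zero_eq_top_iff hp] at h0
    subst h0
    refine ⟨PUnit, inferInstance, inferInstance, inferInstance, inferInstance, M, inferInstance,
      inferInstance, inferInstance, inferInstance,
      (LinearEquiv.uniqueProd (R := Λ) (M := M) (M₂ := PUnit.{u + 1})).symm, 0, map_zero _, ?_⟩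
    have := powLength_anti (p := p) (M := PUnit.{u + 1}) (Nat.zero_le 1)
    rw [powLength_zero_eq_zero_iff.mpr inferInstance] at this ⊢
    omega
  | succ n ih =>
    intro M _ _ _ _ a hn
    have h0 : heightSeq p a 0 ≠ ⊤ := by
      intro h0
      rw [heightSeq_zero_eq_top_iff hp] at h0
      subst h0
      rw [numGaps] at hn
      simp [heightSeq_zero] at hn
    obtain ⟨l, x, h⟩ := exists_isFirstGap (heightSeq_add_one_le a)
      (heightSeq_eventually_top hp a) h0
    obtain ⟨K, f, a', hf, ha'⟩ := h.exists_equiv hp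
    rw [h.numGaps_eq (heightSeq_add_one_le a) (heightSeq_eventually_top hp a), ← ha'] at hn
    obtain ⟨U, _, _, _, _, V, _, _, _, _, g, u, hg, hU⟩ := ih K a' (by omega)
    have := isArtinian_quotient hp (x + l + 1)
    refine ⟨(Λ ⧸ Ideal.span {p ^ (x + l + 1)}) × U, inferInstance, inferInstance, inferInstance,
      inferInstance, V, inferInstance, inferInstance, inferInstance, inferInstance,
      f.trans (((LinearEquiv.refl Λ _).prodCongr g).trans
        (LinearEquiv.prodAssoc Λ _ _ _).symm), (Ideal.Quotient.mk _ (p ^ x), u), ?_, ?_⟩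
    · rw [LinearEquiv.trans_apply, hf]
      change ((Ideal.Quotient.mk _ (p ^ x), (g a').1), (g a').2) = _
      rw [hg]
    -- The exponent `x + l + 1` is positive, so the new summand adds exactly one column.
    · rw [powLength_prod, powLength_prod, powLength_quotient hp, powLength_quotient hp, hU]
      omega

theorem numGaps_le (hp : Irreducible p) [IsNoetherian Λ M] [IsArtinian Λ M] (a : M) {ρ : ℕ → ℕ}
    (h : HasRows p M ρ) : numGaps (heightSeq p a) ≤ ρ 0 := by
  obtain ⟨U, _, _, _, _, V, _, _, _, _, f, u, hf, hU⟩ := exists_equiv_prod_numGaps hp _ M a rfl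
  have h1 := h 0
  rw [powLength_congr f, powLength_congr f, powLength_prod, powLength_prod] at h1
  have h2 := powLength_anti (p := p) (M := V) (Nat.zero_le 1)
  rw [Nat.zero_add] at h1
  omega

/-- Construction of a pair `(M, a)` with prescribed rows and prescribed height sequence. -/
theorem exists_heightSeq_eq (hp : Irreducible p) (n : ℕ) :
    ∀ (ρ : ℕ → ℕ) (m : ℕ → ℕ∞), ρ 0 = n → Antitone ρ → (∃ k, ρ k = 0) →
      (∀ i, m i + 1 ≤ m (i + 1)) → (∃ i, m i = ⊤) →
      (∀ i k : ℕ, m i = k → m i + 1 < m (i + 1) → ρ (k + 1) < ρ k) →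
      ∃ (M : Type u) (_ : AddCommGroup M) (_ : Module Λ M) (_ : IsNoetherian Λ M)
        (_ : IsArtinian Λ M) (a : M), HasRows p M ρ ∧ heightSeq p a = m := by
  induction n using Nat.strong_induction_on with
  | _ n ih =>
  intro ρ m hn hρ hρ0 hm htop hgap
  by_cases h0 : m 0 = ⊤
  · obtain ⟨β, hβ⟩ := exists_youngDiagram hρ hρ0
    have := fun j : Fin (β.rowLen 0) => isArtinian_quotient hp (β.colLen j)
    refine ⟨(j : Fin (β.rowLen 0)) → Λ ⧸ Ideal.span {p ^ β.colLen j}, inferInstance,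
      inferInstance, inferInstance, inferInstance, 0, ?_, ?_⟩
    · rw [← show β.rowLen = ρ from funext hβ]
      exact hasRows_pi hp β
    · funext i
      rw [heightSeq_zero, eq_top_of_le hm h0 (Nat.zero_le i)]
  · obtain ⟨l, x, h⟩ := exists_isFirstGap hm htop h0
    -- The gap condition supplies a column of length `x + l + 1`; it is removed before the induction
    -- and returns as the cyclic summand.
    have hlt : ρ (x + l + 1) < ρ (x + l) :=
      hgap l (x + l) (h.eq_add l le_rfl) ((h.gap_iff l).mpr (Or.inl rfl))
    have hpos : ∀ k, k < x + l + 1 → ρ (x + l + 1) < ρ k := fun k hk =>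
      hlt.trans_le (hρ (by omega))
    suffices hex : ∃ (M : Type u) (_ : AddCommGroup M) (_ : Module Λ M) (_ : IsNoetherian Λ M)
        (_ : IsArtinian Λ M) (a : M),
        HasRows p M (fun k => ρ k - if k < x + l + 1 then 1 else 0) ∧
          heightSeq p a = dropGap l m by
      obtain ⟨M, _, _, _, _, a', hM, ha'⟩ := hex
      have := isArtinian_quotient hp (x + l + 1)
      refine ⟨(Λ ⧸ Ideal.span {p ^ (x + l + 1)}) × M, inferInstance, inferInstance, inferInstance,
        inferInstance, (Ideal.Quotient.mk _ (p ^ x), a'), ?_, ?_⟩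
      · intro k
        rw [powLength_prod, powLength_prod, powLength_quotient hp, powLength_quotient hp, hM k]
        dsimp only
        split_ifs with hk
        · have := hpos k hk
          omega
        · omega
      · funext i
        rw [heightSeq_prod, ha']
        rcases lt_or_ge l i with hi | hi
        · rw [heightSeq_mk_pow _ _ _ (by omega), min_eq_right le_top, dropGap_of_lt m hi]
        · rw [heightSeq_mk_pow_of_lt hp _ _ _ (by omega), min_eq_left (h.lt_dropGap hi).le,
            h.eq_add i hi]
    refine ih ((fun k => ρ k - if k < x + l + 1 then 1 else 0) 0) ?_ _ _ rfl ?_ ?_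
      (h.dropGap_add_one_le hm) ?_ ?_
    · have := hpos 0 (by omega)
      simp only [Nat.succ_pos, if_true]
      omega
    · refine antitone_nat_of_succ_le fun k => ?_
      have h1 : ρ (k + 1) ≤ ρ k := hρ (Nat.le_succ k)
      -- Monotonicity is at risk only at the foot of the removed column, where `hlt` is strict.
      rcases eq_or_ne k (x + l) with rfl | hk
      · rw [if_neg (by omega), if_pos (by omega)]
        omega
      · split_ifs <;> omega
    · obtain ⟨k, hk⟩ := hρ0
      exact ⟨k, by rw [hk, Nat.zero_sub]⟩
    · obtain ⟨i, hi⟩ := htop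
      refine ⟨i + (l + 1), ?_⟩
      rw [dropGap_of_lt m (by omega)]
      exact eq_top_of_le hm hi (by omega)
    · intro i k hik hg
      have hgi := (h.gap_iff i).mpr (Or.inr hg)
      have hil : l < i := by
        rcases lt_trichotomy i l with hi | rfl | hi
        · rw [h.eq_add i hi.le, h.eq_add (i + 1) hi] at hgi
          norm_cast at hgi
          omega
        · exact absurd hg h.not_gap_dropGap
        · exact hi
      rw [dropGap_of_lt m hil] at hik
      have h1 := hgap i k hik hgi
      have h2 := add_le_of_add_one_le hm (l + 1) (i - (l + 1))
      rw [Nat.add_sub_cancel' (by omega), hik] at h2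
      -- The remaining gaps occur at heights above `x + l + 1`, in rows untouched by the removal.
      have h3 : ((x + l + 1 : ℕ) : ℕ∞) < k :=
        h.lt.trans_le (le_trans (le_add_of_nonneg_right zero_le) h2)
      norm_cast at h3
      rw [if_neg (by omega), if_neg (by omega)]
      omega

end Rows

/-! ### Multiplicity-free LR-tableaux as sequences of rows -/

namespace Tableau

theorem mem_boxes_succ {Γ : Tableau} {e i j : ℕ} :
    (i, j) ∈ Γ.boxes (e + 1) ↔ (Γ.part e).rowLen i ≤ j ∧ j < (Γ.part (e + 1)).rowLen i := by
  rw [boxes, Finset.mem_sdiff, YoungDiagram.mem_cells, YoungDiagram.mem_cells,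
    YoungDiagram.mem_iff_lt_rowLen, Nat.add_sub_cancel, YoungDiagram.mem_iff_lt_rowLen, not_lt,
    and_comm]

theorem exists_eq_succ_of_mem_boxes {Γ : Tableau} {e : ℕ} {b : ℕ × ℕ} (h : b ∈ Γ.boxes e) :
    ∃ f, e = f + 1 := by
  cases e with
  | zero => simp [boxes] at h
  | succ f => exact ⟨f, rfl⟩

/-- The entry `e + 1` occurs exactly once, in row `m e`, if `m e` is finite, and does not occur
otherwise; the rows `m e` are strictly increasing. -/
structure HasEntryRows (Γ : Tableau) (m : ℕ → ℕ∞) : Prop where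
  add_one_le : ∀ e, m e + 1 ≤ m (e + 1)
  rowLen_succ : ∀ e k : ℕ, (Γ.part (e + 1)).rowLen k =
    (Γ.part e).rowLen k + if m e = (k : ℕ∞) then 1 else 0

namespace HasEntryRows

variable {Γ : Tableau} {m : ℕ → ℕ∞}

theorem mem_boxes_iff (h : Γ.HasEntryRows m) {e i j : ℕ} :
    (i, j) ∈ Γ.boxes (e + 1) ↔ m e = i ∧ j = (Γ.part e).rowLen i := by
  rw [mem_boxes_succ, h.rowLen_succ]
  split_ifs with hi
  · simp only [hi, true_and]
    omega
  · simp only [hi, false_and, iff_false]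
    omega

theorem lt_of_lt (h : Γ.HasEntryRows m) {e f i j : ℕ} (he : m e = i) (hf : m f = j)
    (hij : i < j) : e < f := by
  by_contra hfe
  have := add_le_of_add_one_le h.add_one_le f (e - f)
  rw [Nat.add_sub_cancel' (not_lt.mp hfe), he, hf] at this
  norm_cast at this
  omega

theorem le_of_eq (h : Γ.HasEntryRows m) {e f i : ℕ} (he : m e = i) (hf : m f = i) : e ≤ f := by
  by_contra hfe
  have := add_le_of_add_one_le h.add_one_le f (e - f)
  rw [Nat.add_sub_cancel' (by omega), he, hf] at this
  norm_cast at this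
  omega

theorem entriesAtMostOnce (h : Γ.HasEntryRows m) : Γ.EntriesAtMostOnce := by
  intro e
  rw [Finset.card_le_one]
  rintro ⟨i, j⟩ hb ⟨i', j'⟩ hb'
  obtain ⟨f, rfl⟩ := exists_eq_succ_of_mem_boxes hb
  rw [h.mem_boxes_iff] at hb hb'
  obtain ⟨h1, rfl⟩ := hb
  obtain ⟨h2, rfl⟩ := hb'
  rw [h1] at h2
  norm_cast at h2
  subst h2
  rfl

/-- Each row contains at most one entry, and larger entries lie lower. For the lattice condition,
the box of `f + 2` is below that of `f + 1`; both sit at the end of their rows, so the latter is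
weakly to the right. -/
theorem isLR (h : Γ.HasEntryRows m) : Γ.IsLR where
  row_weak i j₁ j₂ e₁ e₂ _ h1 h2 := by
    obtain ⟨f₁, rfl⟩ := exists_eq_succ_of_mem_boxes h1
    obtain ⟨f₂, rfl⟩ := exists_eq_succ_of_mem_boxes h2
    rw [h.mem_boxes_iff] at h1 h2
    exact Nat.succ_le_succ (h.le_of_eq h1.1 h2.1)
  col_strict i₁ i₂ j e₁ e₂ hi h1 h2 := by
    obtain ⟨f₁, rfl⟩ := exists_eq_succ_of_mem_boxes h1
    obtain ⟨f₂, rfl⟩ := exists_eq_succ_of_mem_boxes h2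
    rw [h.mem_boxes_iff] at h1 h2
    exact Nat.succ_lt_succ (h.lt_of_lt h1.1 h2.1 hi)
  lattice c e he := by
    obtain ⟨f, rfl⟩ := Nat.exists_eq_add_of_le' he
    rcases Finset.eq_empty_or_nonempty ((Γ.boxes (f + 1 + 1)).filter fun b => c ≤ b.2)
      with h0 | ⟨⟨i', j'⟩, hb⟩
    · rw [h0, Finset.card_empty]
      exact Nat.zero_le _
    · refine ((Finset.card_filter_le _ _).trans (h.entriesAtMostOnce _)).trans
        (Finset.card_pos.mpr ?_)
      rw [Finset.mem_filter, h.mem_boxes_iff] at hb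
      obtain ⟨⟨h1, rfl⟩, h2⟩ := hb
      have hle := h.add_one_le f
      rw [h1] at hle
      have hfin : m f ≠ ⊤ := by
        intro ht
        rw [ht, top_add, top_le_iff] at hle
        exact ENat.natCast_ne_top _ hle
      obtain ⟨i, hi⟩ := ENat.ne_top_iff_exists.mp hfin
      rw [← hi] at hle
      norm_cast at hle
      refine ⟨(i, (Γ.part f).rowLen i), Finset.mem_filter.mpr ⟨h.mem_boxes_iff.mpr ⟨hi.symm, rfl⟩,
        h2.trans ?_⟩⟩
      have hne : m f ≠ (i' : ℕ∞) := by
        rw [← hi]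
        norm_cast
        omega
      dsimp only
      rw [h.rowLen_succ, if_neg hne, add_zero]
      exact (Γ.part f).rowLen_anti i i' (by omega)

theorem unique {m' : ℕ → ℕ∞} (h : Γ.HasEntryRows m) (h' : Γ.HasEntryRows m') : m = m' := by
  funext e
  have key : ∀ k : ℕ, m e = k ↔ m' e = k := by
    intro k
    have h1 := h.rowLen_succ e k
    have h2 := h'.rowLen_succ e k
    by_cases h3 : m e = k <;> by_cases h4 : m' e = k <;> simp_all
  rcases eq_or_ne (m e) ⊤ with ht | ht
  · by_contra hne
    rw [ht] at hne
    obtain ⟨k, hk⟩ := ENat.ne_top_iff_exists.mp (Ne.symm hne)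
    rw [(key k).mpr hk.symm] at ht
    exact ENat.natCast_ne_top _ ht
  · obtain ⟨k, hk⟩ := ENat.ne_top_iff_exists.mp ht
    rw [← hk, (key k).mp hk.symm]

theorem eq_of_eventually_eq {Γ' : Tableau} (h : Γ.HasEntryRows m) (h' : Γ'.HasEntryRows m) {r : ℕ}
    (hr : ∀ i, r ≤ i → Γ.part i = Γ'.part i) : Γ = Γ' := by
  have key : ∀ j i, r ≤ i + j → Γ.part i = Γ'.part i := by
    intro j
    induction j with
    | zero => exact hr
    | succ j ih =>
      intro i hi
      refine YoungDiagram.eq_of_rowLen_eq fun k => ?_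
      have h1 := h.rowLen_succ i k
      have h2 := h'.rowLen_succ i k
      rw [ih (i + 1) (by omega)] at h1
      omega
  exact Tableau.ext (funext fun i => key r i (by omega))

theorem rowLen_eq_of_lt (h : Γ.HasEntryRows m) {e k : ℕ} (hk : (k : ℕ∞) < m e) {j : ℕ}
    (hj : e ≤ j) : (Γ.part j).rowLen k = (Γ.part e).rowLen k := by
  induction j, hj using Nat.le_induction with
  | base => rfl
  | succ j hj ih =>
    have hle := add_le_of_add_one_le h.add_one_le e (j - e)
    rw [Nat.add_sub_cancel' hj] at hle
    have hlt := hk.trans_le (le_trans (le_add_of_nonneg_right zero_le) hle)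
    rw [h.rowLen_succ, ih, if_neg hlt.ne', add_zero]

end HasEntryRows

theorem exists_part_eq_outer (Γ : Tableau) : ∃ r, ∀ i, r ≤ i → Γ.part i = Γ.outer :=
  Γ.exists_isOuter.choose_spec

/-- All entries after `e + 1` lie below row `k + 1`, so rows `k` and `k + 1` are final once row `k`
has received its box. This is the gap condition of `exists_heightSeq_eq`. -/
theorem HasEntryRows.outer_rowLen_lt {Γ : Tableau} {m : ℕ → ℕ∞} (h : Γ.HasEntryRows m) {e k : ℕ}
    (hk : m e = k) (hgap : m e + 1 < m (e + 1)) :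
    Γ.outer.rowLen (k + 1) < Γ.outer.rowLen k := by
  obtain ⟨r, hr⟩ := Γ.exists_part_eq_outer
  rw [hk] at hgap
  have h1 : ((k + 1 : ℕ) : ℕ∞) < m (e + 1) := by exact_mod_cast hgap
  have h0 : (k : ℕ∞) < m (e + 1) := lt_trans (by exact_mod_cast Nat.lt_succ_self k) h1
  rw [← hr (r + (e + 1)) (by omega), h.rowLen_eq_of_lt h0 (by omega),
    h.rowLen_eq_of_lt h1 (by omega), h.rowLen_succ, h.rowLen_succ, if_pos hk, if_neg]
  · exact Nat.lt_succ_of_le ((Γ.part e).rowLen_anti k (k + 1) (Nat.le_succ k))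
  · rw [hk]
    norm_cast
    omega

theorem IsLR.exists_hasEntryRows {Γ : Tableau} (h : Γ.IsLR) (h1 : Γ.EntriesAtMostOnce) :
    ∃ m : ℕ → ℕ∞, Γ.HasEntryRows m ∧ ∃ i, m i = ⊤ := by
  have hm : ∀ e, ∃ x : ℕ∞, ∀ i : ℕ, x = i ↔ ∃ j, (i, j) ∈ Γ.boxes (e + 1) := by
    intro e
    rcases Finset.eq_empty_or_nonempty (Γ.boxes (e + 1)) with h0 | ⟨⟨i, j⟩, hb⟩
    · exact ⟨⊤, fun i => by simp [h0]⟩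
    · refine ⟨i, fun i' => ⟨fun hi => ⟨j, ?_⟩, ?_⟩⟩
      · rw [Nat.cast_inj] at hi
        exact hi ▸ hb
      · rintro ⟨j', hb'⟩
        have := Finset.card_le_one.mp (h1 (e + 1)) _ hb _ hb'
        rw [Prod.mk.injEq] at this
        exact congrArg _ this.1
  choose m hm using hm
  refine ⟨m, ⟨fun e => ?_, fun e k => ?_⟩, ?_⟩
  · rcases eq_or_ne (m (e + 1)) ⊤ with ht | ht
    · rw [ht]
      exact le_top
    obtain ⟨i', hi'⟩ := ENat.ne_top_iff_exists.mp ht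
    obtain ⟨j', hb'⟩ := (hm (e + 1) i').mp hi'.symm
    -- The lattice condition from the column of entry `e + 2` onwards puts entry `e + 1` weakly to
    -- its right. If it were not in a higher row, its box would lie beyond the end of its row in
    -- `Γ.part (e + 1)`.
    have hpos : 0 < ((Γ.boxes (e + 1 + 1)).filter fun b => j' ≤ b.2).card :=
      Finset.card_pos.mpr ⟨(i', j'), Finset.mem_filter.mpr ⟨hb', le_rfl⟩⟩
    obtain ⟨⟨i, j⟩, hb⟩ := Finset.card_pos.mp
      (hpos.trans_le (h.lattice j' (e + 1) (Nat.le_add_left 1 e)))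
    obtain ⟨hb, hj⟩ := Finset.mem_filter.mp hb
    rw [(hm e i).mpr ⟨j, hb⟩, ← hi']
    norm_cast
    by_contra hlt
    rw [mem_boxes_succ] at hb hb'
    have := (Γ.part (e + 1)).rowLen_anti i' i (by omega)
    dsimp only at hj
    omega
  · have hle : (Γ.part e).rowLen k ≤ (Γ.part (e + 1)).rowLen k := by
      refine le_of_forall_lt fun j hj => ?_
      rw [← YoungDiagram.mem_iff_lt_rowLen] at hj ⊢
      exact Γ.mono (Nat.le_succ e) hj
    split_ifs with hk
    · obtain ⟨j, hb⟩ := (hm e k).mp hk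
      rw [mem_boxes_succ] at hb
      by_contra hne
      have hb1 : (k, (Γ.part e).rowLen k) ∈ Γ.boxes (e + 1) := mem_boxes_succ.mpr (by omega)
      have hb2 : (k, (Γ.part e).rowLen k + 1) ∈ Γ.boxes (e + 1) := mem_boxes_succ.mpr (by omega)
      have := Finset.card_le_one.mp (h1 (e + 1)) _ hb1 _ hb2
      rw [Prod.mk.injEq] at this
      omega
    · rw [hm e k] at hk
      by_contra hne
      exact hk ⟨(Γ.part e).rowLen k, mem_boxes_succ.mpr (by omega)⟩
  · obtain ⟨r, hr⟩ := Γ.eventually_const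
    refine ⟨r, ?_⟩
    by_contra ht
    obtain ⟨i, hi⟩ := ENat.ne_top_iff_exists.mp ht
    obtain ⟨j, hb⟩ := (hm r i).mp hi.symm
    rw [mem_boxes_succ, hr (r + 1) (Nat.le_succ r)] at hb
    omega

end Tableau

/-! ### Tableaux of cyclic embeddings -/

instance {Λ : Type u} [CommRing Λ] (E : SubEmbedding Λ) : IsNoetherian Λ E.B :=
  (isFiniteLength_iff_isNoetherian_isArtinian.mp E.finiteLength).1

instance {Λ : Type u} [CommRing Λ] (E : SubEmbedding Λ) : IsArtinian Λ E.B :=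
  (isFiniteLength_iff_isNoetherian_isArtinian.mp E.finiteLength).2

theorem HasRows.of_quotient_span_pow_smul {Λ : Type u} [CommRing Λ] {p : Λ} {M : Type u}
    [AddCommGroup M] [Module Λ M] {a : M} {i : ℕ} {ρ : ℕ → ℕ}
    (h : HasRows p (M ⧸ Submodule.span Λ {p ^ i • a}) ρ) (hi : p ^ i • a = 0) :
    HasRows p M ρ := by
  refine h.congr (Submodule.quotEquivOfEqBot _ ?_)
  rw [hi, Submodule.span_zero_singleton]

section CyclicQuotient

variable {Λ : Type u} [CommRing Λ] [IsDomain Λ] [IsDiscreteValuationRing Λ] {p : Λ}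
variable {M : Type u} [AddCommGroup M] [Module Λ M] [IsNoetherian Λ M] [IsArtinian Λ M]

/-- Differences of `powLength_quotient_span` at `k` and `k + 1`: the conditions `k ≤ h(y)` and `k +
1 ≤ h(y)` differ exactly when `h(y) = k`. -/
theorem HasRows.quotient_span_smul (hp : Irreducible p) {y : M} {ρ ρ' : ℕ → ℕ}
    (h : HasRows p (M ⧸ Submodule.span Λ {y}) ρ)
    (h' : HasRows p (M ⧸ Submodule.span Λ {p • y}) ρ') (k : ℕ) :
    ρ' k = ρ k + if height p y = (k : ℕ∞) then 1 else 0 := by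
  classical
  have hk := h k
  have hk' := h' k
  rw [powLength_quotient_span hp, powLength_quotient_span hp y (k + 1)] at hk'
  by_cases hy : y = 0
  · have : ¬ height p y = (k : ℕ∞) := by
      rw [hy, height_zero]
      exact (ENat.natCast_ne_top k).symm
    simp only [hy, ne_eq, not_true_eq_false, false_and, if_false] at hk hk'
    rw [if_neg this]
    omega
  · obtain ⟨n, hn⟩ := ENat.ne_top_iff_exists.mp (mt (height_eq_top_iff hp).mp hy)
    simp only [ne_eq, hy, not_false_eq_true, true_and, ← natCast_le_height_iff, ← hn,
      Nat.cast_le, Nat.cast_inj] at hk' ⊢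
    split_ifs at hk' ⊢ <;> omega

theorem HasRows.subsingleton (hp : Irreducible p) {β : YoungDiagram} (h : HasRows p M β.rowLen)
    (h0 : β.rowLen 0 = 0) : Subsingleton M := by
  have hβ : ∀ k, β.rowLen k = 0 := fun k => by
    have := β.rowLen_anti 0 k (Nat.zero_le k)
    omega
  obtain ⟨n, hn⟩ := exists_powLength_eq_zero (M := M) hp
  rw [← powLength_zero_eq_zero_iff (Λ := Λ) (p := p)]
  induction n with
  | zero => exact hn
  | succ n ih => exact ih (by rw [h n, hn, hβ])

end CyclicQuotient

namespace SubEmbedding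

section Submodule

variable {Λ : Type u} [CommRing Λ] {p : Λ}

theorem directSum_A_eq_span {E F : SubEmbedding Λ} {x : E.B} {y : F.B}
    (h : (E.directSum F).A = Submodule.span Λ {((x, y) : E.B × F.B)}) (z : E.B × F.B) :
    (z.1 ∈ E.A ∧ z.2 ∈ F.A) ↔ ∃ c : Λ, c • (x, y) = z := by
  rw [← Submodule.mem_span_singleton, ← h]
  exact Iff.rfl

end Submodule

variable {Λ : Type u} [CommRing Λ] [IsDomain Λ] [IsDiscreteValuationRing Λ] {p : Λ}
variable {E F : SubEmbedding Λ}

theorem hasTableau_iff (hp : Irreducible p) {a : E.B} (ha : E.A = Submodule.span Λ {a})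
    {Γ : Tableau} : E.HasTableau p Γ ↔
      ∀ i, HasRows p (E.B ⧸ Submodule.span Λ {p ^ i • a}) (Γ.part i).rowLen := by
  refine forall_congr' fun i => ?_
  have : p ^ i • E.A = Submodule.span Λ {p ^ i • a} := by
    rw [ha, Submodule.smul_span, Set.smul_set_singleton]
  rw [this, hasPartition_iff hp]

theorem HasTableau.hasEntryRows (hp : Irreducible p) {a : E.B} (ha : E.A = Submodule.span Λ {a})
    {Γ : Tableau} (h : E.HasTableau p Γ) : Γ.HasEntryRows (heightSeq p a) := by
  rw [hasTableau_iff hp ha] at h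
  refine ⟨heightSeq_add_one_le a, fun e k => ?_⟩
  have h1 := h (e + 1)
  rw [pow_succ', mul_smul] at h1
  exact (h e).quotient_span_smul hp h1 k

theorem HasTableau.hasRows_outer (hp : Irreducible p) (hE : E.IsCyclic) {Γ : Tableau}
    (h : E.HasTableau p Γ) : HasRows p E.B Γ.outer.rowLen := by
  obtain ⟨a, ha⟩ := hE
  rw [hasTableau_iff hp ha] at h
  obtain ⟨r, hr⟩ := Γ.exists_part_eq_outer
  obtain ⟨n, hn⟩ := exists_pow_smul_eq_zero (M := E.B) hp
  rw [← hr (n + r) (by omega)]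
  refine (h (n + r)).of_quotient_span_pow_smul ?_
  rw [pow_add, mul_smul, hn]

theorem HasTableau.unique (hp : Irreducible p) (hE : E.IsCyclic) {Γ Γ' : Tableau}
    (h : E.HasTableau p Γ) (h' : E.HasTableau p Γ') : Γ = Γ' := by
  obtain ⟨a, ha⟩ := hE
  rw [hasTableau_iff hp ha] at h h'
  exact Tableau.ext (funext fun i => YoungDiagram.eq_of_rowLen_eq fun k =>
    congrFun ((h i).unique (h' i)) k)

theorem exists_hasTableau (hp : Irreducible p) (hE : E.IsCyclic) :
    ∃ Γ : Tableau, E.HasTableau p Γ := by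
  obtain ⟨a, ha⟩ := hE
  have hex := fun i => exists_hasRows (M := E.B ⧸ Submodule.span Λ {p ^ i • a}) hp
  choose β hβ using hex
  have hstep : ∀ i k, (β i).rowLen k ≤ (β (i + 1)).rowLen k := by
    intro i k
    have h1 := hβ (i + 1)
    rw [pow_succ', mul_smul] at h1
    rw [(hβ i).quotient_span_smul hp h1 k]
    exact Nat.le_add_right _ _
  obtain ⟨n, hn⟩ := exists_pow_smul_eq_zero (M := E.B) hp
  have htop : ∀ i, n ≤ i → HasRows p E.B (β i).rowLen := by
    intro i hi
    refine (hβ i).of_quotient_span_pow_smul ?_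
    rw [← Nat.add_sub_cancel' hi, pow_add, mul_smul, hn]
  refine ⟨⟨β, monotone_nat_of_le_succ fun i => ?_, n, fun i hi => ?_⟩,
    (hasTableau_iff hp ha).mpr hβ⟩
  · rintro ⟨j, k⟩ h
    rw [YoungDiagram.mem_iff_lt_rowLen] at h ⊢
    exact h.trans_le (hstep i j)
  · exact YoungDiagram.eq_of_rowLen_eq fun k =>
      congrFun ((htop i hi).unique (htop n le_rfl)) k

theorem HasTableau.of_iso (hp : Irreducible p) (hE : E.IsCyclic) {Γ : Tableau}
    (h : E.HasTableau p Γ) (hEF : E.Iso F) : F.HasTableau p Γ := by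
  obtain ⟨a, ha⟩ := hE
  obtain ⟨f, hf⟩ := hEF
  have hb : F.A = Submodule.span Λ {f a} := by
    rw [← hf, ha, Submodule.map_span, Set.image_singleton]
    rfl
  rw [hasTableau_iff hp ha] at h
  rw [hasTableau_iff hp hb]
  refine fun i => (h i).congr (Submodule.Quotient.equiv _ _ f ?_)
  rw [Submodule.map_span, Set.image_singleton]
  exact congrArg (fun x => Submodule.span Λ {x}) (map_smul f _ _)

theorem iso_of_hasTableau (hp : Irreducible p) (hE : E.IsCyclic) (hF : F.IsCyclic) {Γ : Tableau}
    (h : E.HasTableau p Γ) (h' : F.HasTableau p Γ) : E.Iso F := by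
  have hrows := (h.hasRows_outer hp hE).powLength_eq hp (h'.hasRows_outer hp hF)
  obtain ⟨a, ha⟩ := hE
  obtain ⟨b, hb⟩ := hF
  obtain ⟨f, hf⟩ := exists_equiv_of_heightSeq_eq hp _ E.B F.B a b rfl hrows
    ((h.hasEntryRows hp ha).unique (h'.hasEntryRows hp hb))
  refine ⟨f, ?_⟩
  rw [ha, hb, Submodule.map_span, Set.image_singleton, ← hf]
  rfl

/-- Realize the outer shape and the entry rows by a pair `(M, a)`. Its tableau has the same outer
shape and entry rows, hence equals `Γ`. -/
theorem exists_hasTableau_of_isLR (hp : Irreducible p) {Γ : Tableau} (h : Γ.IsLR)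
    (h1 : Γ.EntriesAtMostOnce) : ∃ E : SubEmbedding Λ, E.IsCyclic ∧ E.HasTableau p Γ := by
  obtain ⟨m, hm, htop⟩ := h.exists_hasEntryRows h1
  have h0 : ∃ k, Γ.outer.rowLen k = 0 := by
    refine ⟨Γ.outer.colLen 0, ?_⟩
    by_contra hne
    have := YoungDiagram.mem_iff_lt_rowLen.mpr (Nat.pos_of_ne_zero hne)
    rw [YoungDiagram.mem_iff_lt_colLen] at this
    exact lt_irrefl _ this
  obtain ⟨M, _, _, _, _, a, hM, ha⟩ := exists_heightSeq_eq (Λ := Λ) hp _ Γ.outer.rowLen m rfl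
    (fun i j hij => Γ.outer.rowLen_anti i j hij) h0 hm.add_one_le htop
    (fun e k hk hgap => hm.outer_rowLen_lt hk hgap)
  let E : SubEmbedding Λ :=
    { B := M
      finiteLength := isFiniteLength_iff_isNoetherian_isArtinian.mpr ⟨inferInstance, inferInstance⟩
      A := Submodule.span Λ {a} }
  have hE : E.IsCyclic := ⟨a, rfl⟩
  obtain ⟨Γ', hΓ'⟩ := exists_hasTableau hp hE
  have hm' : Γ'.HasEntryRows m := ha ▸ hΓ'.hasEntryRows hp (a := a) rfl
  have hout : Γ'.outer = Γ.outer := YoungDiagram.eq_of_rowLen_eq fun k =>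
    congrFun ((hΓ'.hasRows_outer hp hE).unique hM) k
  obtain ⟨r, hr⟩ := Γ.exists_part_eq_outer
  obtain ⟨r', hr'⟩ := Γ'.exists_part_eq_outer
  have : Γ = Γ' := hm.eq_of_eventually_eq hm' (r := r + r') fun i hi => by
    rw [hr i (by omega), hr' i (by omega), hout]
  exact ⟨E, hE, this ▸ hΓ'⟩

/-! ### Poles -/

/-- If `a = u + v` with `u = c a`, then `c` or `1 - c` is a unit, so one of `U`, `V` contains the
generator. -/
theorem isIndecomposableModule_of_isCyclic (hp : Irreducible p) {a : E.B}
    (ha : E.A = Submodule.span Λ {a}) (h0 : E.A ≠ ⊥) : IsIndecomposableModule Λ E.A := by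
  refine ⟨(Submodule.nontrivial_iff_ne_bot).mpr h0, fun U V hUV => ?_⟩
  have haA : a ∈ E.A := ha ▸ Submodule.mem_span_singleton_self a
  have hgen : ∀ W : Submodule Λ E.A, ⟨a, haA⟩ ∈ W → W = ⊤ := by
    intro W hW
    rw [eq_top_iff]
    rintro ⟨x, hx⟩ -
    have hx' := hx
    rw [ha, Submodule.mem_span_singleton] at hx'
    obtain ⟨c, rfl⟩ := hx'
    exact W.smul_mem c hW
  have htop : (⟨a, haA⟩ : E.A) ∈ U ⊔ V := hUV.sup_eq_top ▸ Submodule.mem_top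
  obtain ⟨u, hu, v, hv, huv⟩ := Submodule.mem_sup.mp htop
  obtain ⟨c, hc⟩ := Submodule.mem_span_singleton.mp (ha.le u.2)
  have hc' : c • (⟨a, haA⟩ : E.A) = u := Subtype.ext hc
  rcases dvd_or_isUnit hp c with ⟨d, rfl⟩ | hc
  · left
    have hv' : (1 + p * (-d)) • (⟨a, haA⟩ : E.A) = v := by
      rw [mul_neg, add_smul, one_smul, neg_smul, hc', ← huv, add_neg_cancel_comm]
    rw [← hv', Submodule.smul_mem_iff_of_isUnit _ (isUnit_one_add_mul hp _)] at hv
    have := hUV.inf_eq_bot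
    rwa [hgen V hv, inf_top_eq] at this
  · right
    rw [← hc', Submodule.smul_mem_iff_of_isUnit _ hc] at hu
    have := hUV.inf_eq_bot
    rwa [hgen U hu, top_inf_eq] at this

theorem numGaps_heightSeq_eq_of_isIndecomposable (hp : Irreducible p) {a : E.B}
    (ha : E.A = Submodule.span Λ {a}) (h0 : E.A ≠ ⊥) (hE : E.IsIndecomposable) {ρ : ℕ → ℕ}
    (hρ : HasRows p E.B ρ) : ρ 0 = numGaps (heightSeq p a) := by
  obtain ⟨U, _, _, _, _, V, _, _, _, _, f, u, hf, hU⟩ := exists_equiv_prod_numGaps hp _ E.B a rfl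
  let F : SubEmbedding Λ :=
    { B := U
      finiteLength := isFiniteLength_iff_isNoetherian_isArtinian.mpr ⟨inferInstance, inferInstance⟩
      A := Submodule.span Λ {u} }
  let G : SubEmbedding Λ :=
    { B := V
      finiteLength := isFiniteLength_iff_isNoetherian_isArtinian.mpr ⟨inferInstance, inferInstance⟩
      A := ⊥ }
  have hiso : E.Iso (F.directSum G) := by
    refine ⟨f, ?_⟩
    rw [ha, Submodule.map_span, Set.image_singleton]
    change Submodule.span Λ {f a} = (Submodule.span Λ {u}).prod ⊥
    rw [hf]
    ext ⟨x, y⟩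
    simp only [Submodule.mem_span_singleton, Submodule.mem_prod, Submodule.mem_bot,
      Prod.smul_mk, smul_zero, Prod.mk.injEq, exists_and_right, eq_comm]
  rcases hE.2 F G hiso with hsub | hsub
  · refine absurd ?_ h0
    have hu : u = 0 := hsub.elim u 0
    have ha0 : a = 0 := by
      rw [← f.map_eq_zero_iff, hf, hu]
      rfl
    rw [ha, ha0, Submodule.span_zero_singleton]
  · have hV : Subsingleton V := hsub
    rw [← powLength_zero_eq_zero_iff (Λ := Λ) (p := p)] at hV
    have hV1 := powLength_anti (p := p) (M := V) (Nat.zero_le 1)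
    have h1 := hρ 0
    rw [powLength_congr f, powLength_congr f, powLength_prod, powLength_prod, Nat.zero_add] at h1
    omega

/-- In `F.B` the element `x` has the height sequence of `a`, so `F.B` already uses up all the
columns. -/
theorem subsingleton_of_iso_directSum (hp : Irreducible p) {G : SubEmbedding Λ} {a : E.B}
    {f : E.B ≃ₗ[Λ] F.B × G.B} {x : F.B} (hx : f a = (x, 0)) {ρ : ℕ → ℕ} (hρ : HasRows p E.B ρ)
    (hgaps : ρ 0 = numGaps (heightSeq p a)) : Subsingleton G.B := by
  obtain ⟨β, hβ⟩ := exists_hasRows (M := F.B) hp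
  obtain ⟨γ, hγ⟩ := exists_hasRows (M := G.B) hp
  refine hγ.subsingleton hp ?_
  have hseq : heightSeq p x = heightSeq p a := by
    rw [← heightSeq_congr f, hx]
    funext i
    rw [heightSeq_prod, heightSeq_zero, min_eq_left le_top]
  have h1 := numGaps_le hp x hβ
  have h2 := hρ 0
  rw [powLength_congr f, powLength_congr f, powLength_prod, powLength_prod, hβ 0, hγ 0] at h2
  rw [hseq] at h1
  omega

theorem isIndecomposable_of_numGaps_eq (hp : Irreducible p) {a : E.B}
    (ha : E.A = Submodule.span Λ {a}) (h0 : E.A ≠ ⊥) {ρ : ℕ → ℕ} (hρ : HasRows p E.B ρ)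
    (hgaps : ρ 0 = numGaps (heightSeq p a)) : E.IsIndecomposable := by
  have ha0 : a ≠ 0 := by
    rintro rfl
    exact h0 (by rw [ha, Submodule.span_zero_singleton])
  refine ⟨⟨a, 0, ha0⟩, fun F G ⟨f, hf⟩ => ?_⟩
  change E.B ≃ₗ[Λ] F.B × G.B at f
  obtain ⟨⟨x, y⟩, hxy⟩ : ∃ z, f a = z := ⟨_, rfl⟩
  have hspan : (F.directSum G).A = Submodule.span Λ {((x, y) : F.B × G.B)} := by
    rw [← hf, ha, Submodule.map_span, Set.image_singleton, ← hxy]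
    rfl
  have hmem := directSum_A_eq_span hspan
  -- The submodule is a product, so it contains `(x, 0) = c (x, y)`. If `p ∣ c` then `x = 0`; if `c`
  -- is a unit then `y = 0`.
  obtain ⟨c, hc⟩ := (hmem (x, 0)).mp ⟨((hmem (x, y)).mpr ⟨1, one_smul _ _⟩).1, zero_mem _⟩
  rw [Prod.smul_mk, Prod.mk.injEq] at hc
  rcases dvd_or_isUnit hp c with ⟨d, rfl⟩ | hcu
  · left
    have hx0 : x = 0 := by
      rw [← (isUnit_one_add_mul hp (-d)).smul_eq_zero, mul_neg, add_smul, one_smul, neg_smul,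
        hc.1, add_neg_cancel]
    refine subsingleton_of_iso_directSum (F := G) hp (f := f.trans (LinearEquiv.prodComm Λ _ _))
      (x := y) ?_ hρ hgaps
    rw [LinearEquiv.trans_apply, hxy, hx0]
    rfl
  · right
    rw [hcu.smul_eq_zero] at hc
    exact subsingleton_of_iso_directSum hp (by rw [hxy, hc.2]) hρ hgaps

theorem isPole_iff (hp : Irreducible p) {a : E.B} (ha : E.A = Submodule.span Λ {a})
    {Γ : Tableau} (hΓ : E.HasTableau p Γ) :
    E.IsPole ↔ E.A ≠ ⊥ ∧ Γ.numColumns = numGaps (heightSeq p a) := by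
  have hρ := hΓ.hasRows_outer hp ⟨a, ha⟩
  constructor
  · rintro ⟨h1, h2⟩
    have h0 : E.A ≠ ⊥ := Submodule.nontrivial_iff_ne_bot.mp h1.1
    exact ⟨h0, numGaps_heightSeq_eq_of_isIndecomposable hp ha h0 h2 hρ⟩
  · rintro ⟨h0, hgaps⟩
    exact ⟨isIndecomposableModule_of_isCyclic hp ha h0,
      isIndecomposable_of_numGaps_eq hp ha h0 hρ hgaps⟩

end SubEmbedding

/-! ### The bijection and the pole criterion -/

theorem mainTheorem10 {Λ : Type u} [CommRing Λ] [IsDomain Λ] [IsDiscreteValuationRing Λ]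
    (p : Λ) (hp : Irreducible p) :
    ∃ Φ : CyclicEmbeddingClass Λ ≃ MultiplicityFreeLRTableau,
      (∀ (E : CyclicEmbedding Λ) (Γ : Tableau),
        E.1.HasTableau p Γ ↔ Γ = (Φ E.isoClass).1) ∧
      (∀ (E : CyclicEmbedding Λ) (a : E.1.B), E.1.A = Submodule.span Λ {a} →
        (E.1.IsPole ↔
          E.1.A ≠ ⊥ ∧ (Φ E.isoClass).1.numColumns = numGaps (heightSeq p a))) := by
  have hex : ∀ E : CyclicEmbedding Λ, ∃ Γ : MultiplicityFreeLRTableau, E.1.HasTableau p Γ.1 := by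
    intro E
    obtain ⟨Γ, hΓ⟩ := SubEmbedding.exists_hasTableau hp E.2
    obtain ⟨a, ha⟩ := E.2
    have h := hΓ.hasEntryRows hp ha
    exact ⟨⟨Γ, h.isLR, h.entriesAtMostOnce⟩, hΓ⟩
  choose T hT using hex
  let φ : CyclicEmbeddingClass Λ → MultiplicityFreeLRTableau :=
    Quotient.lift T fun E F hEF =>
      Subtype.ext (((hT E).of_iso hp E.2 hEF).unique hp F.2 (hT F))
  have hφ : Function.Bijective φ := by
    constructor
    · intro E F
      induction E using Quotient.inductionOn with | _ E =>
      induction F using Quotient.inductionOn with | _ F =>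
      intro h
      have h' : T E = T F := h
      exact Quotient.sound (SubEmbedding.iso_of_hasTableau hp E.2 F.2 (hT E) (h' ▸ hT F))
    · rintro ⟨Γ, h, h1⟩
      obtain ⟨E, hE, hΓ⟩ := SubEmbedding.exists_hasTableau_of_isLR (Λ := Λ) hp h h1
      exact ⟨CyclicEmbedding.isoClass ⟨E, hE⟩, Subtype.ext ((hT ⟨E, hE⟩).unique hp hE hΓ)⟩
  refine ⟨Equiv.ofBijective φ hφ, fun E Γ => ⟨fun h => h.unique hp E.2 (hT E), ?_⟩,
    fun E a ha => SubEmbedding.isPole_iff hp ha (hT E)⟩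
  rintro rfl
  exact hT E
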